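/- Let $X_1,X_2,\dots$ be i.i.d. real random variables and suppose $H_0$ holds: the common law is the standard Cauchy distribution $\mathcal C(0,1)$, with density $1/(\pi(1+x^2))$. Let $$h(x_1,x_2,x_3)=\tfrac13\Big(\mathrm I\big\{\tfrac{x_1x_2-1}{2x_2}\le x_3\big\}+\mathrm I\big\{\tfrac{x_1x_3-1}{2x_3}\le x_2\big\}+\mathrm I\big\{\tfrac{x_2x_3-1}{2x_3}\le x_1\big\}\Big)-\tfrac12,$$ and assume $E[h^2(X_1,X_2,X_3)]<\infty$ and $\mathrm{Var}\big[E\{h(X_1,X_2,X_3)\mid X_1\}\big]>0$. For $n\ge 4$ define $$\widehat\Delta^*_n=\binom n3^{-1}\sum_{1\le k<j<i\le n}\mathrm I\Big\{\frac{X_iX_j-1}{2X_j}\le X_k\Big\}-\frac12,\qquad \widehat J_i=n\widehat\Delta^*_n-(n-1)\widehat\Delta^{*(-i)}_{n-1}\quad(1\le i\le n),$$ where $\widehat\Delta^{*(-i)}_{n-1}$ is the same statistic computed from the $n-1$ observations that remain, in their order, when $X_i$ is deleted. Put $\widehat W_i=\widehat J_i$ for $1\le i\le n$, $\widehat W_{n+1}=-\max\big(1,\tfrac12\log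 n\big)\,\tfrac1n\sum_{i=1}^n\widehat J_i$, and $$\mathcal R_n=\max\Big\{\prod_{i=1}^{n+1}(n+1)p_i:\ p_i\ge0,\ \sum_{i=1}^{n+1}p_i=1,\ \sum_{i=1}^{n+1}p_i\widehat W_i=0\Big\}.$$ Then for every $n\ge4$ and every sample (with nonzero observations, which holds almost surely) there is a real number $\widehat\lambda_2$ with $1+\widehat\lambda_2\widehat W_i>0$ for all $i\le n+1$ and $$\frac1{n+1}\sum_{i=1}^{n+1}\frac{\widehat W_i}{1+\widehat\lambda_2\widehat W_i}=0;$$ for every such $\widehat\lambda_2$ the maximum is attained at $\widehat p_i=\frac1{n+1}\,\frac1{1+\widehat\lambda_2\widehat W_i}$, and $$\log\mathcal R_n=-\sum_{i=1}^{n+1}\log\big(1+\widehat\lambda_2\widehat W_i\big).$$ Moreover, as $n\to\infty$, $-2\log\mathcal R_n$ converges in distribution to the chi-squared distribution with one degree of freedom. -/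

import Mathlib

open MeasureTheory ProbabilityTheory Filter

namespace CauchyAJEL

noncomputable section

open scoped Classical in
/-- The indicator `I{(a b - 1) / (2 b) ≤ c}`. -/
def ind (a b c : ℝ) : ℝ := if (a * b - 1) / (2 * b) ≤ c then 1 else 0

/-- The kernel `h` of degree three. -/
def h (x₁ x₂ x₃ : ℝ) : ℝ :=
  (1 / 3) * (ind x₁ x₂ x₃ + ind x₁ x₃ x₂ + ind x₂ x₃ x₁) - 1 / 2

/-- The statistic `Δ̂*` computed from the observations `x i`, `i ∈ s`:
`(|s| choose 3)⁻¹ ∑_{k < j < i} I{(xᵢ xⱼ - 1) / (2 xⱼ) ≤ xₖ} - 1/2`. -/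
def deltaStar (s : Finset ℕ) (x : ℕ → ℝ) : ℝ :=
  ((s.card.choose 3 : ℕ) : ℝ)⁻¹ *
    (∑ i ∈ s, ∑ j ∈ s with j < i, ∑ k ∈ s with k < j, ind (x i) (x j) (x k)) - 1 / 2

/-- The jackknife pseudo-values `Ĵᵢ = n Δ̂*ₙ - (n - 1) Δ̂*ₙ₋₁^{(-i)}` of the sample
`x 0, …, x (n - 1)`. -/
def pseudoValue (n : ℕ) (x : ℕ → ℝ) (i : ℕ) : ℝ :=
  (n : ℝ) * deltaStar (Finset.range n) x
    - ((n : ℝ) - 1) * deltaStar ((Finset.range n).erase i) x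

/-- The `n + 1` values `Ŵᵢ`: the pseudo-values of the sample `x 0, …, x (n - 1)`, followed by the
additional value `- max (1, log n / 2) * (1/n) ∑ᵢ Ĵᵢ`. -/
def adjustedValue (n : ℕ) (x : ℕ → ℝ) (i : Fin (n + 1)) : ℝ :=
  if (i : ℕ) < n then pseudoValue n x i
  else -max 1 ((1 / 2) * Real.log n) * ((1 / (n : ℝ)) * ∑ j ∈ Finset.range n, pseudoValue n x j)

/-- Probability weights `p` on the values `W i` under which these have mean zero. -/
def feasible {m : ℕ} (W : Fin m → ℝ) : Set (Fin m → ℝ) :=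
  {p | (∀ i, 0 ≤ p i) ∧ ∑ i, p i = 1 ∧ ∑ i, p i * W i = 0}

/-- The empirical likelihood `∏ᵢ (m pᵢ)`, relative to uniform weights. -/
def likelihood {m : ℕ} (p : Fin m → ℝ) : ℝ := ∏ i, (m : ℝ) * p i

/-- The empirical likelihood ratio `max {∏ᵢ (m pᵢ) : p feasible}`. -/
def elRatio {m : ℕ} (W : Fin m → ℝ) : ℝ := sSup (likelihood '' feasible W)

/-- The adjusted jackknife empirical likelihood ratio of the sample `x 0, …, x (n - 1)`. -/
def ajelRatio (n : ℕ) (x : ℕ → ℝ) : ℝ := elRatio (adjustedValue n x)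

/-- `l` is a Lagrange multiplier for `W`: it solves
`(1/m) ∑ᵢ Wᵢ / (1 + l Wᵢ) = 0`, and the weights it gives are positive. -/
def IsMultiplier {m : ℕ} (W : Fin m → ℝ) (l : ℝ) : Prop :=
  (∀ i, 0 < 1 + l * W i) ∧ (1 / (m : ℝ)) * ∑ i, W i / (1 + l * W i) = 0

/-- The weights `p̂ᵢ = (1/m) * 1 / (1 + l Wᵢ)`. -/
def multiplierWeight {m : ℕ} (W : Fin m → ℝ) (l : ℝ) (i : Fin m) : ℝ :=
  (1 / (m : ℝ)) * (1 / (1 + l * W i))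

/-- The chi-squared distribution with one degree of freedom: the law of the square of a standard
normal variable. -/
def chiSquaredOne : Measure ℝ := (gaussianReal 0 1).map (fun z => z ^ 2)

instance : IsProbabilityMeasure chiSquaredOne :=
  Measure.isProbabilityMeasure_map (by fun_prop)

end

end CauchyAJEL

/-! For a fixed sample the maximisation is a concave problem. If `l` is a multiplier, multiplying
the inequalities t ≤ exp(t - 1) at t = m pᵢ (1 + l Wᵢ) shows that no feasible weights beat
`multiplierWeight` (`isMaxOn_likelihood`). A multiplier exists because the values Wᵢ, unless all
vanish, take both signs: the extra value has the sign opposite to the mean of the pseudo-values.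

For the limit, let A = ∑ Wᵢ and B = ∑ Wᵢ². With bounded values, l ≈ A/B and -2 log R ≈ A²/B. The
extra value is of order log n / √n and negligible, so with pseudo-values Jᵢ the statistic is close
to (∑ Jᵢ / √n)² / (∑ Jᵢ² / n).

The kernel is summed over k < j < i without symmetrisation, so the projection onto the i-th
observation depends on the position i. Each Jᵢ is close in mean square to `score μ n i (x i)`; the
scores are independent, centred and bounded, but not identically distributed. Both the variance of
their normalized sum and the approximate value of ∑ Jᵢ² / n are `scoreVar μ n`. Hence the ratio
normalizes itself, and `scoreVar` only has to stay away from 0; convergence is not required. The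
mean square approximations rest on `efron_stein`, the Gaussian limit on
`tendstoInDistribution_triangular`.

The Cauchy law contributes two facts. Its symmetry under x ↦ -x makes the centred kernel have mean
zero. And `firstProj` tends to -1/2 at +∞ while the law charges every half-line, so `firstProj` is
not almost everywhere zero; this bounds `scoreVar` below, since for i near n most triples containing
i have it as their largest index. -/

namespace CauchyAJEL

/-! ### Closure properties of bounded measurable functions. -/

/-- Bounded measurable real functions. -/
def BddMeas {β : Type*} [MeasurableSpace β] (f : β → ℝ) : Prop :=
  Measurable f ∧ ∃ C, ∀ x, |f x| ≤ C

namespace BddMeas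

variable {β γ : Type*} [MeasurableSpace β] [MeasurableSpace γ] {f g : β → ℝ}

lemma integrable (hf : BddMeas f) (ν : Measure β) [IsFiniteMeasure ν] : Integrable f ν := by
  obtain ⟨hm, C, hC⟩ := hf
  exact Integrable.of_bound hm.aestronglyMeasurable C (ae_of_all _ hC)

lemma const (c : ℝ) : BddMeas (fun _ : β => c) := ⟨measurable_const, |c|, fun _ => le_rfl⟩

lemma add (hf : BddMeas f) (hg : BddMeas g) : BddMeas (fun x => f x + g x) := by
  obtain ⟨hm, C, hC⟩ := hf
  obtain ⟨hm', C', hC'⟩ := hg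
  exact ⟨hm.add hm', C + C', fun x => (abs_add_le _ _).trans (add_le_add (hC x) (hC' x))⟩

lemma sub (hf : BddMeas f) (hg : BddMeas g) : BddMeas (fun x => f x - g x) := by
  obtain ⟨hm, C, hC⟩ := hf
  obtain ⟨hm', C', hC'⟩ := hg
  exact ⟨hm.sub hm', C + C', fun x => (abs_sub _ _).trans (add_le_add (hC x) (hC' x))⟩

lemma mul (hf : BddMeas f) (hg : BddMeas g) : BddMeas (fun x => f x * g x) := by
  obtain ⟨hm, C, hC⟩ := hf
  obtain ⟨hm', C', hC'⟩ := hg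
  refine ⟨hm.mul hm', C * C', fun x => ?_⟩
  rw [abs_mul]
  exact mul_le_mul (hC x) (hC' x) (abs_nonneg _) ((abs_nonneg _).trans (hC x))

lemma const_mul (c : ℝ) (hf : BddMeas f) : BddMeas (fun x => c * f x) := (const c).mul hf

lemma sq (hf : BddMeas f) : BddMeas (fun x => f x ^ 2) := by
  simpa only [pow_two] using hf.mul hf

lemma sum {κ : Type*} {s : Finset κ} {f : κ → β → ℝ} (hf : ∀ i ∈ s, BddMeas (f i)) :
    BddMeas (fun x => ∑ i ∈ s, f i x) := by
  classical
  induction s using Finset.induction_on with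
  | empty => simpa using const 0
  | insert a s ha ih =>
    simp only [Finset.sum_insert ha]
    exact (hf a (Finset.mem_insert_self _ _)).add
      (ih fun i hi => hf i (Finset.mem_insert_of_mem hi))

lemma comp (hf : BddMeas f) {u : γ → β} (hu : Measurable u) : BddMeas (fun x => f (u x)) := by
  obtain ⟨hm, C, hC⟩ := hf
  exact ⟨hm.comp hu, C, fun x => hC _⟩

lemma integral_right {f : β × γ → ℝ} (hf : BddMeas f) (ν : Measure γ) [IsProbabilityMeasure ν] :
    BddMeas (fun x => ∫ y, f (x, y) ∂ν) := by
  obtain ⟨hm, C, hC⟩ := hf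
  refine ⟨(StronglyMeasurable.integral_prod_right' hm.stronglyMeasurable).measurable, C, fun x => ?_⟩
  simpa using norm_integral_le_of_norm_le_const (μ := ν) (f := fun y => f (x, y))
    (ae_of_all _ fun y => hC (x, y))

end BddMeas

lemma sq_integral_le {β : Type*} [MeasurableSpace β] (ν : Measure β) [IsProbabilityMeasure ν]
    {f : β → ℝ} (hf : BddMeas f) : (∫ x, f x ∂ν) ^ 2 ≤ ∫ x, f x ^ 2 ∂ν := by
  have h0 : 0 ≤ ∫ x, (f x - ∫ y, f y ∂ν) ^ 2 ∂ν := integral_nonneg fun x => sq_nonneg _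
  have h1 : ∫ x, (f x - ∫ y, f y ∂ν) ^ 2 ∂ν = ∫ x, f x ^ 2 ∂ν - (∫ x, f x ∂ν) ^ 2 := by
    have : ∀ x, (f x - ∫ y, f y ∂ν) ^ 2
        = f x ^ 2 - ((2 * ∫ y, f y ∂ν) * f x - (∫ y, f y ∂ν) ^ 2) := fun x => by ring
    simp_rw [this]
    rw [integral_sub (hf.sq.integrable ν)
      (((hf.const_mul _).sub (BddMeas.const _)).integrable ν),
      integral_sub ((hf.const_mul _).integrable ν) (integrable_const _), integral_const_mul]
    simp
    ring
  linarith

/-! ### Resampling one coordinate and the Efron–Stein inequality. -/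

section Resample

variable {ι α : Type*} [DecidableEq ι] [MeasurableSpace α] (μ : Measure α) [IsProbabilityMeasure μ]

/-- Replacing one coordinate of an i.i.d. family by a fresh copy does not change its law. -/
lemma map_update_infinitePi (i : ι) :
    ((Measure.infinitePi (fun _ : ι => μ)).prod μ).map
      (fun p => Function.update p.1 i p.2) = Measure.infinitePi (fun _ : ι => μ) := by
  have hmeas : Measurable (fun p : (ι → α) × α => Function.update p.1 i p.2) :=
    measurable_update'
  refine Measure.eq_infinitePi _ fun s t ht => ?_
  rw [Measure.map_apply hmeas (MeasurableSet.pi s.countable_toSet fun i _ => ht i)]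
  by_cases hi : i ∈ s
  · have : (fun p : (ι → α) × α => Function.update p.1 i p.2) ⁻¹' (Set.pi s t)
        = (Set.pi (s.erase i : Finset ι) t) ×ˢ t i := by
      ext ⟨x, a⟩
      simp only [Set.mem_preimage, Set.mem_pi, Set.mem_prod, Finset.coe_erase, Set.mem_sdiff,
        Finset.mem_coe, Set.mem_singleton_iff]
      constructor
      · intro hh
        refine ⟨fun j hj => ?_, ?_⟩
        · simpa [Function.update_of_ne hj.2] using hh j hj.1
        · simpa using hh i hi
      · rintro ⟨h1, h2⟩ j hj
        by_cases hji : j = i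
        · subst hji; simpa using h2
        · simpa [Function.update_of_ne hji] using h1 j ⟨hj, hji⟩
    rw [this, Measure.prod_prod, Measure.infinitePi_pi _ (fun i _ => ht i), mul_comm,
      Finset.mul_prod_erase s (fun i => μ (t i)) hi]
  · have : (fun p : (ι → α) × α => Function.update p.1 i p.2) ⁻¹' (Set.pi s t)
        = (Set.pi s t) ×ˢ Set.univ := by
      ext ⟨x, a⟩
      simp only [Set.mem_preimage, Set.mem_pi, Set.mem_prod, Finset.mem_coe, Set.mem_univ, and_true]
      refine forall₂_congr fun j hj => ?_
      rw [Function.update_of_ne (by rintro rfl; exact hi hj)]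
    rw [this, Measure.prod_prod, Measure.infinitePi_pi _ (fun i _ => ht i)]
    simp

/-- Fubini for the product law, in the form used throughout: the inner integral acts as the
conditional expectation given all coordinates but `i`. -/
lemma integral_resample {E : Type*} [NormedAddCommGroup E] [NormedSpace ℝ E] (i : ι)
    {F : (ι → α) → E} (hF : Integrable F (Measure.infinitePi (fun _ : ι => μ))) :
    ∫ x, ∫ a, F (Function.update x i a) ∂μ ∂(Measure.infinitePi (fun _ : ι => μ))
      = ∫ x, F x ∂(Measure.infinitePi (fun _ : ι => μ)) := by
  have hmeas : Measurable (fun p : (ι → α) × α => Function.update p.1 i p.2) :=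
    measurable_update'
  have hF' := hF
  rw [← map_update_infinitePi μ i] at hF'
  conv_rhs => rw [← map_update_infinitePi μ i]
  rw [integral_map hmeas.aemeasurable hF'.aestronglyMeasurable,
    integral_prod (fun p : (ι → α) × α => F (Function.update p.1 i p.2))
      (hF'.comp_measurable hmeas)]

lemma BddMeas.update {F : (ι → α) → ℝ} (hF : BddMeas F) (i : ι) :
    BddMeas (fun p : (ι → α) × α => F (Function.update p.1 i p.2)) :=
  hF.comp measurable_update'

lemma BddMeas.update_left {F : (ι → α) → ℝ} (hF : BddMeas F) (i : ι) (a : α) :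
    BddMeas (fun x => F (Function.update x i a)) :=
  hF.comp measurable_update_left

lemma BddMeas.update_right {F : (ι → α) → ℝ} (hF : BddMeas F) (i : ι) (x : ι → α) :
    BddMeas (fun a => F (Function.update x i a)) :=
  hF.comp (measurable_update x)

/-- The mean square of the change of `F` when the `i`-th coordinate is replaced by a fresh copy. -/
noncomputable def influence (F : (ι → α) → ℝ) (i : ι) : ℝ :=
  ∫ x, ∫ a, (F x - F (Function.update x i a)) ^ 2 ∂μ ∂(Measure.infinitePi (fun _ : ι => μ))

lemma influence_le {F : (ι → α) → ℝ} (hF : BddMeas F) {i : ι} {c : ℝ}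
    (h : ∀ x a, |F x - F (Function.update x i a)| ≤ c) : influence μ F i ≤ c ^ 2 := by
  have hb : BddMeas (fun p : (ι → α) × α => (F p.1 - F (Function.update p.1 i p.2)) ^ 2) :=
    ((hF.comp measurable_fst).sub (hF.update i)).sq
  have hle : ∀ x a, (F x - F (Function.update x i a)) ^ 2 ≤ c ^ 2 := fun x a =>
    sq_le_sq' (by linarith [neg_abs_le (F x - F (Function.update x i a)), h x a])
      ((le_abs_self _).trans (h x a))
  calc influence μ F i ≤ ∫ x, c ^ 2 ∂(Measure.infinitePi (fun _ : ι => μ)) := by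
        refine integral_mono ((hb.integral_right μ).integrable _) (integrable_const _) fun x => ?_
        calc ∫ a, (F x - F (Function.update x i a)) ^ 2 ∂μ ≤ ∫ a, c ^ 2 ∂μ :=
              integral_mono ((((BddMeas.const (F x)).sub (hF.update_right i x)).sq).integrable _)
                (integrable_const _) fun a => hle x a
          _ = c ^ 2 := by simp
    _ = c ^ 2 := by simp

/-- Averaging over coordinate `i` commutes with resampling coordinate `j`. Jensen's inequality moves
the square inside the average, and `integral_resample` absorbs the average into the outer integral.
-/
lemma influence_average_le {F : (ι → α) → ℝ} (hF : BddMeas F) {i j : ι} (hij : j ≠ i) :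
    influence μ (fun x => ∫ a, F (Function.update x i a) ∂μ) j ≤ influence μ F j := by
  have hG : BddMeas (fun x => ∫ a, F (Function.update x i a) ∂μ) := (hF.update i).integral_right μ
  set V : (ι → α) → ℝ := fun x => ∫ b, (F x - F (Function.update x j b)) ^ 2 ∂μ with hV
  have hVb : BddMeas V :=
    (((hF.comp measurable_fst).sub (hF.update j)).sq).integral_right μ
  have h1 : influence μ F j = ∫ x, ∫ a, V (Function.update x i a) ∂μ
      ∂(Measure.infinitePi (fun _ : ι => μ)) := by
    rw [integral_resample μ i (hVb.integrable _)]; rfl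
  rw [h1]
  have hb3 : ∀ x, BddMeas (fun p : α × α =>
      (F (Function.update x i p.2) - F (Function.update (Function.update x i p.2) j p.1)) ^ 2) := by
    intro x
    refine ((hF.comp ?_).sub (hF.comp ?_)).sq
    · exact (measurable_update x).comp measurable_snd
    · exact measurable_update'.comp (((measurable_update x).comp measurable_snd).prodMk measurable_fst)
  refine integral_mono
    ((((hG.comp measurable_fst).sub (hG.update j)).sq.integral_right μ).integrable _)
    (((hVb.update i).integral_right μ).integrable _) fun x => ?_
  have h2 : ∫ a, V (Function.update x i a) ∂μ = ∫ b, ∫ a, (F (Function.update x i a)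
      - F (Function.update (Function.update x i a) j b)) ^ 2 ∂μ ∂μ := by
    rw [integral_integral_swap]
    exact ((hb3 x).comp measurable_swap).integrable (μ.prod μ)
  simp only [h2]
  refine integral_mono
    ((((BddMeas.const _).sub (hG.update_right j x)).sq).integrable _)
    (((hb3 x).integral_right μ).integrable _) fun b => ?_
  have h3 : (∫ a, F (Function.update x i a) ∂μ)
      - ∫ a, F (Function.update (Function.update x j b) i a) ∂μ
      = ∫ a, (F (Function.update x i a)
        - F (Function.update (Function.update x i a) j b)) ∂μ := by
    rw [← integral_sub ((hF.update_right i x).integrable _) ((hF.update_right i _).integrable _)]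
    congr 1
    ext a
    rw [Function.update_comm hij]
  simp only [h3]
  refine sq_integral_le μ ((hF.update_right i x).sub ?_)
  simp_rw [Function.update_comm hij.symm]
  exact hF.update_right i _

/-- The **Efron–Stein inequality** for bounded functions of finitely many coordinates. -/
theorem efron_stein (s : Finset ι) {F : (ι → α) → ℝ} (hF : BddMeas F) (hs : DependsOn F s) :
    ∫ x, (F x - ∫ y, F y ∂(Measure.infinitePi (fun _ : ι => μ))) ^ 2
      ∂(Measure.infinitePi (fun _ : ι => μ)) ≤ ∑ i ∈ s, influence μ F i := by
  induction s using Finset.induction_on generalizing F with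
  | empty =>
    have hc : ∀ x y, F x = F y := fun x y => hs (by simp)
    have : ∀ x, F x - ∫ y, F y ∂(Measure.infinitePi (fun _ : ι => μ)) = 0 := by
      intro x
      rw [integral_congr_ae (ae_of_all _ fun y => hc y x)]
      simp
    simp [this]
  | insert i s hi ih =>
    set Q := Measure.infinitePi (fun _ : ι => μ) with hQ
    set G : (ι → α) → ℝ := fun x => ∫ a, F (Function.update x i a) ∂μ with hG
    have hGb : BddMeas G := (hF.update i).integral_right μ
    have hGs : DependsOn G s := by
      intro x y hxy
      simp only [hG]
      congr 1
      ext a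
      refine hs fun j hj => ?_
      by_cases hji : j = i
      · subst hji; simp
      · rw [Function.update_of_ne hji, Function.update_of_ne hji]
        refine hxy j ?_
        simpa [hji] using hj
    have hGm : ∫ x, G x ∂Q = ∫ x, F x ∂Q := integral_resample μ i (hF.integrable _)
    have hGu : ∀ x a, G (Function.update x i a) = G x := by
      intro x a; simp [hG]
    set c := ∫ x, F x ∂Q with hc
    -- `G` is the average of `F` over coordinate `i`, so `F - G` is orthogonal to every function
    -- that ignores that coordinate.
    have hcross : ∫ x, (F x - G x) * (G x - c) ∂Q = 0 := by
      rw [← integral_resample μ i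
        (((hF.sub hGb).mul (hGb.sub (BddMeas.const c))).integrable _)]
      simp_rw [hGu, integral_mul_const]
      have : ∀ x, ∫ a, (F (Function.update x i a) - G x) ∂μ = 0 := by
        intro x
        rw [integral_sub ((hF.update_right i x).integrable _) (integrable_const _)]
        simp [hG]
      simp [this]
    have hsplit : ∫ x, (F x - c) ^ 2 ∂Q
        = ∫ x, (F x - G x) ^ 2 ∂Q + ∫ x, (G x - c) ^ 2 ∂Q := by
      have : ∀ x, (F x - c) ^ 2
          = (F x - G x) ^ 2 + (2 * ((F x - G x) * (G x - c)) + (G x - c) ^ 2) := fun x => by ring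
      simp_rw [this]
      have hb1 := (hF.sub hGb).mul (hGb.sub (BddMeas.const c))
      have hb2 := (hGb.sub (BddMeas.const c)).sq
      rw [integral_add ((hF.sub hGb).sq.integrable _) (((hb1.const_mul 2).add hb2).integrable _),
        integral_add ((hb1.const_mul 2).integrable _) (hb2.integrable _), integral_const_mul,
        hcross]
      ring
    -- Jensen here loses the factor 1/2 of the sharp inequality, which is harmless for orders of
    -- magnitude.
    have h1 : ∫ x, (F x - G x) ^ 2 ∂Q ≤ influence μ F i := by
      refine integral_mono ((hF.sub hGb).sq.integrable _)
        (((((hF.comp measurable_fst).sub (hF.update i)).sq).integral_right μ).integrable _)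
        fun x => ?_
      have : F x - G x = ∫ a, (F x - F (Function.update x i a)) ∂μ := by
        rw [integral_sub (integrable_const _) ((hF.update_right i x).integrable _)]
        simp [hG]
      simp only [this]
      exact sq_integral_le μ ((BddMeas.const _).sub (hF.update_right i x))
    have h2 := ih hGb hGs
    rw [hGm] at h2
    have h3 : ∑ j ∈ s, influence μ G j ≤ ∑ j ∈ s, influence μ F j :=
      Finset.sum_le_sum fun j hj => influence_average_le μ hF (by rintro rfl; exact hi hj)
    rw [Finset.sum_insert hi, hsplit]
    linarith

end Resample

/-! ### Duality for the empirical likelihood and existence of multipliers. -/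

section EmpiricalLikelihood

variable {m : ℕ} {W : Fin m → ℝ} {l : ℝ}

lemma IsMultiplier.sum_eq_zero (hl : IsMultiplier W l) : ∑ i, W i / (1 + l * W i) = 0 := by
  rcases Nat.eq_zero_or_pos m with rfl | hm
  · simp
  · have h := hl.2
    have : (1 / (m : ℝ)) ≠ 0 := by positivity
    exact (mul_eq_zero.1 h).resolve_left this

lemma multiplierWeight_mem_feasible (hm : 0 < m) (hl : IsMultiplier W l) :
    multiplierWeight W l ∈ feasible W := by
  have h0 := hl.sum_eq_zero
  have hm' : (m : ℝ) ≠ 0 := by positivity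
  refine ⟨fun i => ?_, ?_, ?_⟩
  · have := hl.1 i
    unfold multiplierWeight
    positivity
  · have : ∀ i, 1 / (1 + l * W i) = 1 - l * (W i / (1 + l * W i)) := by
      intro i
      have := (hl.1 i).ne'
      field_simp
      ring
    simp only [multiplierWeight]
    rw [← Finset.mul_sum]
    simp_rw [this]
    rw [Finset.sum_sub_distrib, ← Finset.mul_sum, h0]
    simp [hm']
  · have : ∀ i, multiplierWeight W l i * W i = (1 / (m : ℝ)) * (W i / (1 + l * W i)) := by
      intro i
      unfold multiplierWeight
      ring
    simp_rw [this, ← Finset.mul_sum, h0, mul_zero]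

lemma likelihood_multiplierWeight (hm : 0 < m) :
    likelihood (multiplierWeight W l) = (∏ i, (1 + l * W i))⁻¹ := by
  have hm' : (m : ℝ) ≠ 0 := by positivity
  unfold likelihood multiplierWeight
  rw [← Finset.prod_inv_distrib]
  refine Finset.prod_congr rfl fun i _ => ?_
  field_simp

/-- The bound t ≤ exp(t - 1) turns the product into the exponential of a sum, and the constraints on
`p` make that sum vanish. -/
lemma isMaxOn_likelihood (hm : 0 < m) (hl : IsMultiplier W l) :
    IsMaxOn likelihood (feasible W) (multiplierWeight W l) := by
  rintro p ⟨hp0, hp1, hp2⟩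
  simp only [Set.mem_ofPred_eq]
  have hpos : 0 < ∏ i, (1 + l * W i) := Finset.prod_pos fun i _ => hl.1 i
  rw [likelihood_multiplierWeight hm, ← one_div, le_div_iff₀ hpos]
  unfold likelihood
  rw [← Finset.prod_mul_distrib]
  calc ∏ i, (m : ℝ) * p i * (1 + l * W i)
      ≤ ∏ i, Real.exp ((m : ℝ) * p i * (1 + l * W i) - 1) := by
        refine Finset.prod_le_prod (fun i _ => ?_) fun i _ => ?_
        · have := hp0 i
          have := (hl.1 i).le
          positivity
        · linarith [Real.add_one_le_exp ((m : ℝ) * p i * (1 + l * W i) - 1)]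
    _ = 1 := by
        rw [← Real.exp_sum]
        have : ∑ i, ((m : ℝ) * p i * (1 + l * W i) - 1)
            = m * ∑ i, p i + m * l * ∑ i, p i * W i - m := by
          rw [Finset.mul_sum, Finset.mul_sum, ← Finset.sum_add_distrib, Finset.sum_sub_distrib]
          simp only [Finset.sum_const, Finset.card_univ, Fintype.card_fin, nsmul_eq_mul, mul_one]
          congr 1
          exact Finset.sum_congr rfl fun i _ => by ring
        rw [this, hp1, hp2]
        simp

lemma log_elRatio (hm : 0 < m) (hl : IsMultiplier W l) :
    Real.log (elRatio W) = -∑ i, Real.log (1 + l * W i) := by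
  have h1 : elRatio W = likelihood (multiplierWeight W l) := by
    unfold elRatio
    refine IsGreatest.csSup_eq ⟨⟨_, multiplierWeight_mem_feasible hm hl, rfl⟩, ?_⟩
    rintro _ ⟨p, hp, rfl⟩
    exact isMaxOn_likelihood hm hl hp
  rw [h1, likelihood_multiplierWeight hm, Real.log_inv, Real.log_prod fun i _ => (hl.1 i).ne']

/-- Provides one endpoint for the intermediate value theorem: near the pole -1 / max W the term of
the largest value dominates. -/
lemma exists_nonpos_multiplier_bound (hpos : ∃ i, 0 < W i) :
    ∃ l ≤ 0, (∀ i, 0 < 1 + l * W i) ∧ 0 ≤ ∑ i, W i / (1 + l * W i) := by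
  obtain ⟨i₀, hi₀⟩ := hpos
  obtain ⟨j, -, hj⟩ := Finset.exists_max_image Finset.univ W ⟨i₀, Finset.mem_univ _⟩
  have hWj : 0 < W j := hi₀.trans_le (hj i₀ (Finset.mem_univ _))
  set B : ℝ := ∑ i, |W i| with hB
  have hBj : W j ≤ B := (le_abs_self _).trans
    (Finset.single_le_sum (f := fun i => |W i|) (fun i _ => abs_nonneg _) (Finset.mem_univ j))
  have hB0 : 0 < B := hWj.trans_le hBj
  -- With this choice the term of the largest value equals exactly `B = ∑ |W i|`. The other terms
  -- are at least `-|W i|`, because for negative values the denominator is at least 1.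
  set l : ℝ := -1 / W j + 1 / B with hl
  have hl0 : l ≤ 0 := by
    have := one_div_le_one_div_of_le hWj hBj
    rw [hl, neg_div]; linarith
  have hlj : 1 + l * W j = W j / B := by
    rw [hl]; field_simp; ring
  have h1 : ∀ i, 0 < 1 + l * W i := by
    intro i
    have : l * W j ≤ l * W i := mul_le_mul_of_nonpos_left (hj i (Finset.mem_univ _)) hl0
    have : 0 < W j / B := by positivity
    linarith
  refine ⟨l, hl0, h1, ?_⟩
  rw [← Finset.add_sum_erase _ _ (Finset.mem_univ j), hlj]
  have h2 : W j / (W j / B) = B := by field_simp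
  rw [h2]
  have h3 : -∑ i ∈ Finset.univ.erase j, |W i| ≤ ∑ i ∈ Finset.univ.erase j, W i / (1 + l * W i) := by
    rw [← Finset.sum_neg_distrib]
    refine Finset.sum_le_sum fun i _ => ?_
    rcases le_total 0 (W i) with h | h
    · have : 0 ≤ W i / (1 + l * W i) := div_nonneg h (h1 i).le
      linarith [abs_nonneg (W i)]
    · rw [abs_of_nonpos h, neg_neg, le_div_iff₀ (h1 i)]
      have : 0 ≤ l * W i := mul_nonneg_of_nonpos_of_nonpos hl0 h
      nlinarith
  have h4 : ∑ i ∈ Finset.univ.erase j, |W i| ≤ B :=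
    Finset.sum_le_sum_of_subset_of_nonneg (Finset.erase_subset _ _) fun i _ _ => abs_nonneg _
  linarith

lemma exists_isMultiplier (hpos : ∃ i, 0 < W i) (hneg : ∃ i, W i < 0) :
    ∃ l, IsMultiplier W l := by
  obtain ⟨a, ha0, ha1, ha2⟩ := exists_nonpos_multiplier_bound hpos
  -- The right endpoint comes from the same bound for `-W`, with `l` replaced by `-l`.
  obtain ⟨b, hb0, hb1, hb2⟩ := exists_nonpos_multiplier_bound (W := fun i => -W i)
    (by simpa using hneg)
  have hseg : ∀ l ∈ Set.Icc a (-b), ∀ i, 0 < 1 + l * W i := by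
    rintro l ⟨h1, h2⟩ i
    have hbi : 0 < 1 + -b * W i := by have := hb1 i; linarith
    rcases le_total 0 (W i) with h | h
    · have := mul_le_mul_of_nonneg_right h1 h
      linarith [ha1 i]
    · have := mul_le_mul_of_nonpos_right h2 h
      linarith
  have hcont : ContinuousOn (fun l => ∑ i, W i / (1 + l * W i)) (Set.Icc a (-b)) := by
    refine continuousOn_finsetSum _ fun i _ => ?_
    exact continuousOn_const.div (by fun_prop) fun l hl => (hseg l hl i).ne'
  have hb3 : ∑ i, W i / (1 + -b * W i) ≤ 0 := by
    have : ∑ i, W i / (1 + -b * W i) = -∑ i, -W i / (1 + b * -W i) := by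
      rw [← Finset.sum_neg_distrib]
      refine Finset.sum_congr rfl fun i _ => ?_
      rw [neg_div, neg_neg, mul_neg, neg_mul]
    linarith
  obtain ⟨l, hl, hl0⟩ := intermediate_value_Icc' (by linarith) hcont ⟨hb3, ha2⟩
  exact ⟨l, hseg l hl, by simp only at hl0; rw [hl0, mul_zero]⟩

end EmpiricalLikelihood

/-- If the pseudo-values have nonzero sum, one of them shares its sign and the extra value has the
opposite one. If the sum is zero, either they take both signs or all values vanish, and then `l = 0`
works. -/
lemma exists_isMultiplier_adjustedValue {n : ℕ} (hn : 0 < n) (x : ℕ → ℝ) :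
    ∃ l, IsMultiplier (adjustedValue n x) l := by
  have hlt : ∀ (i : ℕ) (hi : i < n),
      adjustedValue n x ⟨i, by omega⟩ = pseudoValue n x i := fun i hi => by
    simp [adjustedValue, hi]
  have hlast : adjustedValue n x (Fin.last n) = -max 1 ((1 / 2) * Real.log n) *
      ((1 / (n : ℝ)) * ∑ j ∈ Finset.range n, pseudoValue n x j) := by
    simp [adjustedValue]
  have hn' : (0 : ℝ) < 1 / n := by positivity
  have hmax : 0 < max 1 ((1 / 2) * Real.log n) := lt_max_of_lt_left one_pos
  set T := ∑ j ∈ Finset.range n, pseudoValue n x j with hT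
  rcases lt_trichotomy T 0 with h | h | h
  · obtain ⟨i, hi, hi'⟩ := Finset.exists_lt_of_sum_lt
      (s := Finset.range n) (f := pseudoValue n x) (g := fun _ => 0) (by simpa using h)
    refine exists_isMultiplier ⟨Fin.last n, ?_⟩ ⟨⟨i, by have := Finset.mem_range.1 hi; omega⟩, ?_⟩
    · rw [hlast]
      have : 0 < max 1 ((1 / 2) * Real.log n) * ((1 / (n : ℝ)) * -T) :=
        mul_pos hmax (mul_pos hn' (by linarith))
      linarith
    · rwa [hlt i (Finset.mem_range.1 hi)]
  · by_cases hall : ∀ i ∈ Finset.range n, pseudoValue n x i = 0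
    · have : ∀ i, adjustedValue n x i = 0 := by
        intro i
        unfold adjustedValue
        split_ifs with hi
        · exact hall _ (Finset.mem_range.2 hi)
        · rw [← hT, h]; simp
      exact ⟨0, by simp [IsMultiplier, this]⟩
    · push Not at hall
      obtain ⟨j, hj, hj0⟩ := hall
      obtain ⟨i, hi, hi'⟩ := Finset.exists_pos_of_sum_zero_of_exists_nonzero _ h ⟨j, hj, hj0⟩
      obtain ⟨i₂, hi₂, hi₂'⟩ := Finset.exists_pos_of_sum_zero_of_exists_nonzero
        (fun i => -pseudoValue n x i) (s := Finset.range n)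
        (by rw [Finset.sum_neg_distrib, ← hT, h, neg_zero]) ⟨j, hj, neg_ne_zero.2 hj0⟩
      refine exists_isMultiplier ⟨⟨i, by have := Finset.mem_range.1 hi; omega⟩, ?_⟩
        ⟨⟨i₂, by have := Finset.mem_range.1 hi₂; omega⟩, ?_⟩
      · rwa [hlt i (Finset.mem_range.1 hi)]
      · rw [hlt i₂ (Finset.mem_range.1 hi₂)]; linarith
  · obtain ⟨i, hi, hi'⟩ := Finset.exists_lt_of_sum_lt
      (s := Finset.range n) (f := fun _ => 0) (g := pseudoValue n x) (by simpa using h)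
    refine exists_isMultiplier ⟨⟨i, by have := Finset.mem_range.1 hi; omega⟩, ?_⟩ ⟨Fin.last n, ?_⟩
    · rwa [hlt i (Finset.mem_range.1 hi)]
    · rw [hlast]
      have : 0 < max 1 ((1 / 2) * Real.log n) * ((1 / (n : ℝ)) * T) := mul_pos hmax (mul_pos hn' h)
      linarith

/-! ### Measurability through finite range. -/

section Measurability

lemma measurable_ind : Measurable (fun p : ℝ × ℝ × ℝ => ind p.1 p.2.1 p.2.2) := by
  unfold ind
  refine Measurable.ite (measurableSet_le (by fun_prop) (by fun_prop)) (by fun_prop) (by fun_prop)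

lemma ind_nonneg (a b c : ℝ) : 0 ≤ ind a b c := by unfold ind; split_ifs <;> norm_num

lemma ind_le_one (a b c : ℝ) : ind a b c ≤ 1 := by unfold ind; split_ifs <;> norm_num

/-- Measurable functions with finite range. -/
def FiniteMeas {β γ : Type*} [MeasurableSpace β] [MeasurableSpace γ] (f : β → γ) : Prop :=
  Measurable f ∧ (Set.range f).Finite

namespace FiniteMeas

variable {β γ δ : Type*} [MeasurableSpace β] [MeasurableSpace γ] [MeasurableSpace δ]

/-- Every subset of a finite range is measurable, so `u` needs no regularity. This handles
`elRatio`, a supremum over a set that varies with the data. -/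
lemma comp [MeasurableSingletonClass γ] {f : β → γ} (hf : FiniteMeas f) (u : γ → δ) : FiniteMeas (fun x => u (f x)) := by
  refine ⟨fun t _ => ?_, ?_⟩
  · have : (fun x => u (f x)) ⁻¹' t = f ⁻¹' (u ⁻¹' t ∩ Set.range f) := by
      ext x; simp
    rw [this]
    exact hf.1 (hf.2.subset Set.inter_subset_right).measurableSet
  · rw [show (fun x => u (f x)) = u ∘ f from rfl, Set.range_comp]
    exact hf.2.image u

lemma const (c : γ) : FiniteMeas (fun _ : β => c) :=
  ⟨measurable_const, (Set.finite_singleton c).subset (by rintro _ ⟨x, rfl⟩; rfl)⟩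

lemma pi {κ : Type*} [Finite κ] {f : β → κ → γ} (hf : ∀ i, FiniteMeas (fun x => f x i)) :
    FiniteMeas f := by
  refine ⟨measurable_pi_lambda _ fun i => (hf i).1, ?_⟩
  refine (Set.Finite.pi' fun i => (hf i).2).subset ?_
  rintro _ ⟨x, rfl⟩ i
  exact ⟨x, rfl⟩

lemma add {f g : β → ℝ} (hf : FiniteMeas f) (hg : FiniteMeas g) :
    FiniteMeas (fun x => f x + g x) := by
  refine ⟨hf.1.add hg.1, (hf.2.image2 (· + ·) hg.2).subset ?_⟩
  rintro _ ⟨x, rfl⟩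
  exact ⟨f x, ⟨x, rfl⟩, g x, ⟨x, rfl⟩, rfl⟩

lemma sum {κ : Type*} {s : Finset κ} {f : κ → β → ℝ} (hf : ∀ i ∈ s, FiniteMeas (f i)) :
    FiniteMeas (fun x => ∑ i ∈ s, f i x) := by
  classical
  induction s using Finset.induction_on with
  | empty => simpa using const 0
  | insert a s ha ih =>
    simp only [Finset.sum_insert ha]
    exact (hf a (Finset.mem_insert_self _ _)).add
      (ih fun i hi => hf i (Finset.mem_insert_of_mem hi))

end FiniteMeas

lemma finiteMeas_deltaStar (s : Finset ℕ) : FiniteMeas (deltaStar s) := by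
  have h : FiniteMeas (fun x : ℕ → ℝ =>
      ∑ i ∈ s, ∑ j ∈ s with j < i, ∑ k ∈ s with k < j, ind (x i) (x j) (x k)) := by
    refine FiniteMeas.sum fun i _ => FiniteMeas.sum fun j _ => FiniteMeas.sum fun k _ => ⟨?_, ?_⟩
    · exact measurable_ind.comp (by fun_prop : Measurable fun x : ℕ → ℝ => (x i, x j, x k))
    · refine (Set.toFinite {0, 1}).subset ?_
      rintro _ ⟨x, rfl⟩
      by_cases h : (x i * x j - 1) / (2 * x j) ≤ x k <;> simp [ind, h]
  exact h.comp fun t => ((s.card.choose 3 : ℕ) : ℝ)⁻¹ * t - 1 / 2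

lemma finiteMeas_pseudoValue (n i : ℕ) : FiniteMeas (fun x => pseudoValue n x i) := by
  have h1 := (finiteMeas_deltaStar (Finset.range n)).comp fun t => (n : ℝ) * t
  have h2 := (finiteMeas_deltaStar ((Finset.range n).erase i)).comp fun t => -(((n : ℝ) - 1) * t)
  simpa [pseudoValue, sub_eq_add_neg] using h1.add h2

lemma finiteMeas_adjustedValue (n : ℕ) : FiniteMeas (adjustedValue n) := by
  refine FiniteMeas.pi fun i => ?_
  unfold adjustedValue
  split_ifs with hi
  · exact finiteMeas_pseudoValue n i
  · exact (FiniteMeas.sum (s := Finset.range n) fun j _ => finiteMeas_pseudoValue n j).comp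
      fun t => -max 1 ((1 / 2) * Real.log n) * ((1 / (n : ℝ)) * t)

lemma measurable_ajelRatio (n : ℕ) : Measurable (ajelRatio n) :=
  ((finiteMeas_adjustedValue n).comp elRatio).1

end Measurability

/-! ### Deterministic expansion of the log-likelihood ratio. -/

lemma abs_log_one_add_sub_le {u : ℝ} (hu : |u| ≤ 1 / 2) :
    |Real.log (1 + u) - (u - u ^ 2 / 2)| ≤ 2 * |u| ^ 3 := by
  have h1 : |(-u)| < 1 := by rw [abs_neg]; linarith
  have h := Real.abs_log_sub_add_sum_range_le h1 2
  simp only [Finset.sum_range_succ, Finset.sum_range_zero, abs_neg] at h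
  norm_num at h
  have h2 : |u| ^ 3 / (1 - |u|) ≤ 2 * |u| ^ 3 := by
    rw [div_le_iff₀ (by linarith)]
    have : 0 ≤ |u| ^ 3 := by positivity
    nlinarith
  refine le_trans (le_of_eq ?_) (h.trans h2)
  congr 1
  ring

section Expansion

variable {m : ℕ} {W : Fin m → ℝ} {l K : ℝ}

/-- Summing W = W / (1 + l W) + l W² / (1 + l W) expresses the sum of the values through `l`; then
each denominator is at most 1 + |l| K. This controls `l` once the sum is small against the sum of
squares. -/
lemma IsMultiplier.abs_mul_le (hl : IsMultiplier W l) (hW : ∀ i, |W i| ≤ K) (hK : 0 ≤ K) :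
    |l| * ∑ i, W i ^ 2 ≤ |∑ i, W i| * (1 + |l| * K) := by
  have h0 := hl.sum_eq_zero
  have h1 : ∑ i, W i = l * ∑ i, W i ^ 2 / (1 + l * W i) := by
    have : ∀ i, W i = W i / (1 + l * W i) + l * (W i ^ 2 / (1 + l * W i)) := by
      intro i
      have : 1 + W i * l ≠ 0 := by rw [mul_comm]; exact (hl.1 i).ne'
      field_simp
    calc ∑ i, W i = ∑ i, (W i / (1 + l * W i) + l * (W i ^ 2 / (1 + l * W i))) :=
          Finset.sum_congr rfl fun i _ => this i
      _ = _ := by rw [Finset.sum_add_distrib, h0, zero_add, Finset.mul_sum]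
  have hpos : 0 < 1 + |l| * K := by positivity
  have h2 : (∑ i, W i ^ 2) / (1 + |l| * K) ≤ ∑ i, W i ^ 2 / (1 + l * W i) := by
    rw [Finset.sum_div]
    refine Finset.sum_le_sum fun i _ => div_le_div_of_nonneg_left (sq_nonneg _) (hl.1 i) ?_
    have : l * W i ≤ |l| * K := (le_abs_self _).trans
      (by rw [abs_mul]; exact mul_le_mul_of_nonneg_left (hW i) (abs_nonneg _))
    linarith
  have h3 : 0 ≤ ∑ i, W i ^ 2 / (1 + l * W i) :=
    Finset.sum_nonneg fun i _ => div_nonneg (sq_nonneg _) (hl.1 i).le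
  rw [h1, abs_mul, abs_of_nonneg h3, mul_assoc]
  refine mul_le_mul_of_nonneg_left ?_ (abs_nonneg _)
  rwa [div_le_iff₀ hpos] at h2

/-- The second order expansion of the empirical log-likelihood ratio. -/
lemma IsMultiplier.abs_two_mul_sum_log_sub_le (hl : IsMultiplier W l) (hW : ∀ i, |W i| ≤ K)
    (hK : 0 ≤ K) (hB : 0 < ∑ i, W i ^ 2) (hAB : 4 * K * |∑ i, W i| ≤ ∑ i, W i ^ 2) :
    |2 * ∑ i, Real.log (1 + l * W i) - (∑ i, W i) ^ 2 / ∑ i, W i ^ 2|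
      ≤ 48 * K * |∑ i, W i| ^ 3 / (∑ i, W i ^ 2) ^ 2 := by
  have hmain := hl.abs_mul_le hW hK
  have h0 := hl.sum_eq_zero
  set A := ∑ i, W i with hA
  set B := ∑ i, W i ^ 2 with hBdef
  -- By `hAB` the term |l| K |A| is at most |l| B / 4 and is absorbed on the left.
  have hl1 : |l| * B ≤ 2 * |A| := by nlinarith [abs_nonneg l, abs_nonneg A]
  have hlK : |l| * K ≤ 1 / 2 := by
    have : |l| * K * B ≤ 1 / 2 * B := by nlinarith
    exact le_of_mul_le_mul_right this hB
  have hu : ∀ i, |l * W i| ≤ 1 / 2 := fun i => by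
    rw [abs_mul]
    exact (mul_le_mul_of_nonneg_left (hW i) (abs_nonneg _)).trans hlK
  have hcube : ∀ i, |W i| ^ 3 ≤ K * W i ^ 2 := fun i => by
    rw [pow_succ, sq_abs, mul_comm]
    exact mul_le_mul_of_nonneg_right (hW i) (sq_nonneg _)
  have he : |A - l * B| ≤ 2 * l ^ 2 * K * B := by
    have h1 : A - l * B = -∑ i, l ^ 2 * W i ^ 3 / (1 + l * W i) := by
      have : ∀ i, W i / (1 + l * W i)
          = W i - l * W i ^ 2 + l ^ 2 * W i ^ 3 / (1 + l * W i) := by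
        intro i
        have : 1 + W i * l ≠ 0 := by rw [mul_comm]; exact (hl.1 i).ne'
        field_simp
        ring
      rw [Finset.sum_congr rfl fun i _ => this i, Finset.sum_add_distrib, Finset.sum_sub_distrib,
        ← Finset.mul_sum] at h0
      linarith
    rw [h1, abs_neg]
    refine (Finset.abs_sum_le_sum_abs _ _).trans ?_
    rw [hBdef, Finset.mul_sum]
    refine Finset.sum_le_sum fun i _ => ?_
    have h2 : 1 / 2 ≤ 1 + l * W i := by linarith [neg_abs_le (l * W i), hu i]
    rw [abs_div, abs_of_pos (hl.1 i), div_le_iff₀ (hl.1 i), abs_mul, abs_pow, abs_pow, sq_abs]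
    have h3 := mul_le_mul_of_nonneg_left (hcube i) (sq_nonneg l)
    have h4 : 0 ≤ l ^ 2 * (K * W i ^ 2) := by positivity
    nlinarith
  have hlog : |∑ i, Real.log (1 + l * W i) - (l * A - l ^ 2 * B / 2)| ≤ 2 * |l| ^ 3 * K * B := by
    have h1 : ∑ i, Real.log (1 + l * W i) - (l * A - l ^ 2 * B / 2)
        = ∑ i, (Real.log (1 + l * W i) - (l * W i - (l * W i) ^ 2 / 2)) := by
      rw [Finset.sum_sub_distrib, Finset.sum_sub_distrib, ← Finset.mul_sum, ← Finset.sum_div]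
      simp_rw [mul_pow, ← Finset.mul_sum, hA, hBdef]
    rw [h1]
    refine (Finset.abs_sum_le_sum_abs _ _).trans ?_
    rw [hBdef, Finset.mul_sum]
    refine Finset.sum_le_sum fun i _ => (abs_log_one_add_sub_le (hu i)).trans ?_
    rw [abs_mul, mul_pow]
    have := mul_le_mul_of_nonneg_left (hcube i) (by positivity : 0 ≤ 2 * |l| ^ 3)
    linarith
  -- Completing the square: the quadratic approximation is maximal at l = A / B, so an error in `l`
  -- enters only squared.
  have hexp : 2 * (l * A - l ^ 2 * B / 2) - A ^ 2 / B = -((A - l * B) ^ 2 / B) := by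
    field_simp
    ring
  have hsq : (A - l * B) ^ 2 / B ≤ 2 * |l| ^ 3 * K * B := by
    rw [div_le_iff₀ hB]
    have h1 : (A - l * B) ^ 2 ≤ (2 * l ^ 2 * K * B) ^ 2 := by
      rw [← sq_abs]
      exact pow_le_pow_left₀ (abs_nonneg _) he 2
    have h2 : (2 * l ^ 2 * K * B) ^ 2 = 4 * (|l| ^ 3 * K * B * B) * (|l| * K) := by
      rw [← sq_abs l]; ring
    have h3 : 0 ≤ |l| ^ 3 * K * B * B := by positivity
    nlinarith
  have hsq0 : 0 ≤ (A - l * B) ^ 2 / B := by positivity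
  have htot : |2 * ∑ i, Real.log (1 + l * W i) - A ^ 2 / B| ≤ 6 * |l| ^ 3 * K * B := by
    rw [abs_le] at hlog ⊢
    constructor <;> linarith [hlog.1, hlog.2]
  refine htot.trans ?_
  rw [le_div_iff₀ (by positivity)]
  -- The constant is 48 = 6 · 2³, from |l| B ≤ 2 |A|.
  have h5 : (|l| * B) ^ 3 ≤ (2 * |A|) ^ 3 := pow_le_pow_left₀ (by positivity) hl1 3
  have h6 : 6 * |l| ^ 3 * K * B * B ^ 2 = 6 * K * (|l| * B) ^ 3 := by ring
  rw [h6]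
  nlinarith

end Expansion

/-- Continuity of a² / b at (σ u, σ²), uniform in `σ` and `u`: in the application `σ` varies with n
and need not converge. -/
lemma exists_ratio_bound {c M ε : ℝ} (hc : 0 < c) (hM : 0 ≤ M) (hε : 0 < ε) :
    ∃ δ > 0, δ ≤ c / 2 ∧ ∀ a b σ u : ℝ, c ≤ σ ^ 2 → |a| ≤ M → |a - σ * u| ≤ δ → |b - σ ^ 2| ≤ δ →
      |a ^ 2 / b - u ^ 2| ≤ ε := by
  -- `L` bounds |a + σ u| + u² once δ ≤ 1, so the numerator a² - b u² is at most δ L; the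
  -- denominator is at least c / 2.
  set L := 2 * M + 1 + (M + 1) ^ 2 / c with hL
  have hL0 : 0 < L := by positivity
  refine ⟨min (min (c / 2) 1) (ε * (c / 2) / L), by positivity,
    (min_le_left _ _).trans (min_le_left _ _), fun a b σ u hσ ha h1 h2 => ?_⟩
  set δ := min (min (c / 2) 1) (ε * (c / 2) / L) with hδ
  have hδ0 : 0 < δ := by positivity
  have hδc : δ ≤ c / 2 := (min_le_left _ _).trans (min_le_left _ _)
  have hδ1 : δ ≤ 1 := (min_le_left _ _).trans (min_le_right _ _)
  have hδL : δ * L ≤ ε * (c / 2) := by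
    rw [← le_div_iff₀ hL0]; exact min_le_right _ _
  have hb : c / 2 ≤ b := by linarith [(abs_le.1 h2).1]
  have hb0 : 0 < b := by linarith
  have hsu : |σ * u| ≤ M + 1 := by
    have := abs_sub_abs_le_abs_sub (σ * u) a
    rw [abs_sub_comm] at this
    linarith
  have hu2 : u ^ 2 ≤ (M + 1) ^ 2 / c := by
    rw [le_div_iff₀ hc]
    have h3 : (σ * u) ^ 2 ≤ (M + 1) ^ 2 := by
      rw [← sq_abs]
      exact pow_le_pow_left₀ (abs_nonneg _) hsu 2
    nlinarith [sq_nonneg u]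
  have hnum : |a ^ 2 - b * u ^ 2| ≤ δ * L := by
    have h3 : a ^ 2 - b * u ^ 2 = (a - σ * u) * (a + σ * u) - (b - σ ^ 2) * u ^ 2 := by ring
    rw [h3]
    refine (abs_sub _ _).trans ?_
    rw [abs_mul, abs_mul, abs_of_nonneg (sq_nonneg u)]
    have h4 : |a + σ * u| ≤ 2 * M + 1 := (abs_add_le _ _).trans (by linarith)
    have h5 := mul_le_mul h1 h4 (abs_nonneg _) hδ0.le
    have h6 := mul_le_mul h2 hu2 (sq_nonneg _) hδ0.le
    rw [hL]; linarith
  have h7 : a ^ 2 / b - u ^ 2 = (a ^ 2 - b * u ^ 2) / b := by field_simp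
  rw [h7, abs_div, abs_of_pos hb0, div_le_iff₀ hb0]
  nlinarith

lemma tendsto_adjustment_div_sqrt :
    Tendsto (fun n : ℕ => max 1 ((1 / 2) * Real.log n) / √n) atTop (nhds 0) := by
  have h1 : Tendsto (fun n : ℕ => (1 : ℝ) / √n) atTop (nhds 0) :=
    tendsto_const_nhds.div_atTop (Real.tendsto_sqrt_atTop.comp tendsto_natCast_atTop_atTop)
  have h2 : Tendsto (fun n : ℕ => Real.log n / √n) atTop (nhds 0) := by
    have h := (isLittleO_log_rpow_atTop (r := 1 / 2) (by norm_num)).tendsto_div_nhds_zero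
    have h' := h.comp tendsto_natCast_atTop_atTop
    refine h'.congr fun n => ?_
    simp [Real.sqrt_eq_rpow]
  have h3 : Tendsto (fun n : ℕ => (1 : ℝ) / √n + (1 / 2) * (Real.log n / √n)) atTop (nhds 0) := by
    simpa using h1.add (h2.const_mul (2 : ℝ)⁻¹)
  refine squeeze_zero (fun n => by positivity) (fun n => ?_) h3
  have hlog : 0 ≤ Real.log n := Real.log_natCast_nonneg n
  have : max 1 ((1 / 2) * Real.log n) ≤ 1 + (1 / 2) * Real.log n :=
    max_le (by linarith) (by linarith)
  calc _ ≤ (1 + (1 / 2) * Real.log n) / √n := by gcongr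
    _ = _ := by ring

lemma scaled_cube_div_sq {s n k a b : ℝ} (hs : s ≠ 0) (hn : s * s = n) (hb : b ≠ 0) :
    k * (s * a) ^ 3 / (n * b) ^ 2 = 1 / s * (k * a ^ 3 / b ^ 2) := by
  subst hn
  field_simp

/-- In the scale s = √n the sum and the sum of squares are √n a and n b, with `a` bounded and `b`
bounded below, so the error of the expansion is of order 1 / √n. -/
lemma IsMultiplier.abs_two_mul_sum_log_sub_le_scaled {m : ℕ} {W : Fin m → ℝ}
    {l K M c s n a b : ℝ} (hl : IsMultiplier W l) (hW : ∀ i, |W i| ≤ K) (hK : 0 ≤ K) (hs : 0 < s)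
    (hn : s * s = n) (hA : ∑ i, W i = s * a) (hB : ∑ i, W i ^ 2 = n * b) (ha : |a| ≤ M)
    (hc : 0 < c) (hb : c ≤ b) (hs' : 1 / s * (4 * K * M) ≤ c) :
    |2 * ∑ i, Real.log (1 + l * W i) - a ^ 2 / b| ≤ 1 / s * (48 * K * M ^ 3 / c ^ 2) := by
  have hb0 : 0 < b := hc.trans_le hb
  have hn0 : 0 < n := by rw [← hn]; positivity
  have hcond : 4 * K * |s * a| ≤ n * b := by
    rw [abs_mul, abs_of_pos hs]
    have h1 : 4 * K * M ≤ c * s := by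
      rw [one_div, inv_mul_le_iff₀ hs] at hs'; linarith
    have h2 : 4 * K * |a| ≤ 4 * K * M := mul_le_mul_of_nonneg_left ha (by positivity)
    have h3 : c * s ≤ b * s := mul_le_mul_of_nonneg_right hb hs.le
    calc 4 * K * (s * |a|) = s * (4 * K * |a|) := by ring
      _ ≤ s * (b * s) := mul_le_mul_of_nonneg_left (by linarith) hs.le
      _ = n * b := by rw [← hn]; ring
  have hexp := hl.abs_two_mul_sum_log_sub_le hW hK
  rw [hA, hB] at hexp
  have hq : (s * a) ^ 2 / (n * b) = a ^ 2 / b := by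
    rw [mul_pow, pow_two s, hn, mul_div_mul_left _ _ hn0.ne']
  have hexp' := hexp (by positivity) hcond
  rw [hq, abs_mul, abs_of_pos hs, scaled_cube_div_sq hs.ne' hn hb0.ne'] at hexp'
  refine hexp'.trans ?_
  have h0 : 0 ≤ 48 * K := by positivity
  have h1 : |a| ^ 3 ≤ M ^ 3 := pow_le_pow_left₀ (abs_nonneg _) ha 3
  have h2 : c ^ 2 ≤ b ^ 2 := pow_le_pow_left₀ hc.le hb 2
  exact mul_le_mul_of_nonneg_left (div_le_div₀
    (mul_nonneg h0 ((pow_nonneg (abs_nonneg _) 3).trans h1))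
    (mul_le_mul_of_nonneg_left h1 h0) (by positivity) h2) (by positivity)

/-- The statistic `-2 log R` is close to `u ^ 2` when the pseudo-values are bounded, their
normalized sum is close to `σ u` and their mean square is close to `σ ^ 2`. -/
lemma exists_abs_log_ajelRatio_bound {K c M ε : ℝ} (hK : 0 < K) (hc : 0 < c) (hM : 0 < M)
    (hε : 0 < ε) :
    ∃ δ > 0, ∀ᶠ n : ℕ in atTop, ∀ (x : ℕ → ℝ) (σ u : ℝ), c ≤ σ ^ 2 →
      (∀ i < n, |pseudoValue n x i| ≤ K) →
      |(∑ i ∈ Finset.range n, pseudoValue n x i) / √n| ≤ M →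
      |(∑ i ∈ Finset.range n, pseudoValue n x i) / √n - σ * u| ≤ δ →
      |(∑ i ∈ Finset.range n, pseudoValue n x i ^ 2) / n - σ ^ 2| ≤ δ →
      |-2 * Real.log (ajelRatio n x) - u ^ 2| ≤ ε := by
  obtain ⟨δ, hδ, hδc, hratio⟩ := exists_ratio_bound hc hM.le (half_pos hε)
  refine ⟨δ / 2, half_pos hδ, ?_⟩
  have hinv : Tendsto (fun n : ℕ => (1 : ℝ) / √n) atTop (nhds 0) :=
    tendsto_const_nhds.div_atTop (Real.tendsto_sqrt_atTop.comp tendsto_natCast_atTop_atTop)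
  have ev1 : ∀ᶠ n : ℕ in atTop, max 1 ((1 / 2) * Real.log n) / √n
      ≤ min 1 (min (K / M) (min (δ / (2 * M)) (δ / (2 * M ^ 2)))) :=
    tendsto_adjustment_div_sqrt.eventually_le_const (by positivity)
  have ev2 : ∀ᶠ n : ℕ in atTop, (1 : ℝ) / √n
      ≤ min (c / 2 / (4 * K * M)) (ε / 2 / (48 * K * M ^ 3 / (c / 2) ^ 2)) :=
    hinv.eventually_le_const (by positivity)
  filter_upwards [ev1, ev2, eventually_ge_atTop 1] with n hn1 hn2 hn x σ u hσ hJ hdM hdu hS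
  have hn0 : (0 : ℝ) < n := by exact_mod_cast hn
  have hs0 : 0 < √(n : ℝ) := Real.sqrt_pos.2 hn0
  have hs1 : 1 ≤ √(n : ℝ) := Real.one_le_sqrt.2 (by exact_mod_cast hn)
  have hss : √(n : ℝ) * √n = n := Real.mul_self_sqrt hn0.le
  set a := max 1 ((1 / 2) * Real.log n) with ha
  have ha1 : 1 ≤ a := le_max_left _ _
  set r := a / √n with hr
  have hr0 : 0 ≤ r := by positivity
  have hr1 : r ≤ 1 := hn1.trans (min_le_left _ _)
  have hrK : r * M ≤ K := by
    rw [← le_div_iff₀ hM]; exact hn1.trans ((min_le_right _ _).trans (min_le_left _ _))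
  have hrM : r * (2 * M) ≤ δ := by
    rw [← le_div_iff₀ (by positivity)]
    exact hn1.trans ((min_le_right _ _).trans ((min_le_right _ _).trans (min_le_left _ _)))
  have hrM2 : r * (2 * M ^ 2) ≤ δ := by
    rw [← le_div_iff₀ (by positivity)]
    exact hn1.trans ((min_le_right _ _).trans ((min_le_right _ _).trans (min_le_right _ _)))
  have hn3 : 1 / √(n : ℝ) * (4 * K * M) ≤ c / 2 := by
    rw [← le_div_iff₀ (by positivity)]; exact hn2.trans (min_le_left _ _)
  have hn4 : 1 / √(n : ℝ) * (48 * K * M ^ 3 / (c / 2) ^ 2) ≤ ε / 2 := by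
    rw [← le_div_iff₀ (by positivity)]; exact hn2.trans (min_le_right _ _)
  set t₁ := ∑ i ∈ Finset.range n, pseudoValue n x i with ht₁
  set t₂ := ∑ i ∈ Finset.range n, pseudoValue n x i ^ 2 with ht₂
  set d := t₁ / √n with hd
  have ht₁d : t₁ = √n * d := by rw [hd]; field_simp
  set w := -a * ((1 / (n : ℝ)) * t₁) with hw
  have hwd : w = -(r * d) := by
    rw [hw, ht₁d, hr, show 1 / (n : ℝ) = 1 / (√n * √n) by rw [hss]]; field_simp
  have hlt : ∀ i : Fin n, adjustedValue n x i.castSucc = pseudoValue n x i := fun i => by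
    simp [adjustedValue]
  have hlast : adjustedValue n x (Fin.last n) = w := by
    simp [adjustedValue, hw, ha, ht₁]
  have hA : ∑ i, adjustedValue n x i = √n * d + w := by
    rw [Fin.sum_univ_castSucc, hlast, ← ht₁d, ht₁, Finset.sum_range]
    simp_rw [hlt]
  have hB : ∑ i, adjustedValue n x i ^ 2 = t₂ + w ^ 2 := by
    rw [Fin.sum_univ_castSucc, hlast, ht₂, Finset.sum_range]
    simp_rw [hlt]
  have hWK : ∀ i, |adjustedValue n x i| ≤ K := by
    intro i
    refine Fin.lastCases ?_ (fun j => ?_) i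
    · rw [hlast, hwd, abs_neg, abs_mul, abs_of_nonneg hr0]
      exact (mul_le_mul_of_nonneg_left hdM hr0).trans hrK
    · rw [hlt]; exact hJ j j.2
  obtain ⟨l, hl⟩ := exists_isMultiplier_adjustedValue hn x
  have hlog : -2 * Real.log (ajelRatio n x)
      = 2 * ∑ i, Real.log (1 + l * adjustedValue n x i) := by
    unfold ajelRatio
    rw [log_elRatio (Nat.succ_pos n) hl]; ring
  clear_value w d r a t₁ t₂
  -- The extra value is -r d. It multiplies the normalized sum by 1 - ρ and adds ρ² d² to the mean
  -- square; `A'` and `B'` are the perturbed quantities, and the half of δ left over covers the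
  -- change.
  obtain ⟨ρ, hρ⟩ : ∃ ρ, ρ = r / √n := ⟨_, rfl⟩
  have hρ0 : 0 ≤ ρ := by rw [hρ]; positivity
  have hρr : ρ ≤ r := by rw [hρ]; exact div_le_self hr0 hs1
  obtain ⟨A', hA'⟩ : ∃ A', A' = (1 - ρ) * d := ⟨_, rfl⟩
  obtain ⟨B', hB'⟩ : ∃ B', B' = t₂ / n + ρ ^ 2 * d ^ 2 := ⟨_, rfl⟩
  have hAA : √n * d + w = √n * A' := by
    rw [hwd, hA', hρ]; field_simp; ring
  have hBB : t₂ + w ^ 2 = n * B' := by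
    rw [hwd, hB', hρ, div_pow, Real.sq_sqrt hn0.le]; field_simp
  have hd2 : d ^ 2 ≤ M ^ 2 := by
    rw [← sq_abs]; exact pow_le_pow_left₀ (abs_nonneg _) hdM 2
  have hA'M : |A'| ≤ M := by
    rw [hA', abs_mul, abs_of_nonneg (by linarith : 0 ≤ 1 - ρ)]
    calc (1 - ρ) * |d| ≤ 1 * |d| := mul_le_mul_of_nonneg_right (by linarith) (abs_nonneg _)
      _ ≤ M := by linarith
  have hA'u : |A' - σ * u| ≤ δ := by
    have h1 : A' - σ * u = (d - σ * u) - ρ * d := by rw [hA']; ring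
    rw [h1]
    refine (abs_sub _ _).trans ?_
    rw [abs_mul, abs_of_nonneg hρ0]
    have : ρ * |d| ≤ r * M := mul_le_mul hρr hdM (abs_nonneg _) hr0
    linarith
  have hB'σ : |B' - σ ^ 2| ≤ δ := by
    have h1 : B' - σ ^ 2 = (t₂ / n - σ ^ 2) + ρ ^ 2 * d ^ 2 := by rw [hB']; ring
    rw [h1]
    refine (abs_add_le _ _).trans ?_
    rw [abs_of_nonneg (by positivity : 0 ≤ ρ ^ 2 * d ^ 2)]
    have h2 : ρ ^ 2 ≤ r :=
      (pow_le_of_le_one hρ0 (hρr.trans hr1) two_ne_zero).trans hρr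
    have : ρ ^ 2 * d ^ 2 ≤ r * M ^ 2 := mul_le_mul h2 hd2 (sq_nonneg _) hr0
    linarith
  have hB'c : c / 2 ≤ B' := by linarith [(abs_le.1 hB'σ).1]
  have hB'0 : 0 < B' := by linarith
  have hexp := (hl.abs_two_mul_sum_log_sub_le_scaled hWK hK.le hs0 hss (hA.trans hAA)
    (hB.trans hBB) hA'M (half_pos hc) hB'c hn3).trans hn4
  have hfin := hratio A' B' σ u hσ hA'M hA'u hB'σ
  rw [hlog]
  calc _ = |(2 * ∑ i, Real.log (1 + l * adjustedValue n x i) - A' ^ 2 / B')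
        + (A' ^ 2 / B' - u ^ 2)| := by congr 1; ring
    _ ≤ _ := abs_add_le _ _
    _ ≤ ε := by linarith

/-! ### A central limit theorem for triangular arrays. -/

lemma norm_prod_sub_prod_le {κ : Type*} (s : Finset κ) {u v : κ → ℂ} (hu : ∀ i ∈ s, ‖u i‖ ≤ 1)
    (hv : ∀ i ∈ s, ‖v i‖ ≤ 1) : ‖∏ i ∈ s, u i - ∏ i ∈ s, v i‖ ≤ ∑ i ∈ s, ‖u i - v i‖ := by
  classical
  induction s using Finset.induction_on with
  | empty => simp
  | insert a s ha ih =>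
    rw [Finset.prod_insert ha, Finset.prod_insert ha, Finset.sum_insert ha]
    have h1 : u a * ∏ i ∈ s, u i - v a * ∏ i ∈ s, v i
        = (u a - v a) * ∏ i ∈ s, u i + v a * (∏ i ∈ s, u i - ∏ i ∈ s, v i) := by ring
    rw [h1]
    refine (norm_add_le _ _).trans ?_
    rw [norm_mul, norm_mul]
    have h2 : ‖∏ i ∈ s, u i‖ ≤ 1 := by
      rw [norm_prod]
      exact Finset.prod_le_one (fun i _ => norm_nonneg _)
        fun i hi => hu i (Finset.mem_insert_of_mem hi)
    have h3 := ih (fun i hi => hu i (Finset.mem_insert_of_mem hi))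
      (fun i hi => hv i (Finset.mem_insert_of_mem hi))
    have h4 := hv a (Finset.mem_insert_self _ _)
    refine add_le_add (mul_le_of_le_one_right (norm_nonneg _) h2) ?_
    calc _ ≤ 1 * ‖∏ i ∈ s, u i - ∏ i ∈ s, v i‖ := mul_le_mul_of_nonneg_right h4 (norm_nonneg _)
      _ ≤ _ := by rw [one_mul]; exact h3

section CLT

variable {ι α : Type*} [DecidableEq ι] [MeasurableSpace α] (μ : Measure α) [IsProbabilityMeasure μ]

lemma integral_prod_infinitePi (s : Finset ι) {φ : ι → α → ℂ} (hm : ∀ i, Measurable (φ i))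
    (hb : ∀ i a, ‖φ i a‖ ≤ 1) :
    ∫ x, ∏ i ∈ s, φ i (x i) ∂(Measure.infinitePi (fun _ : ι => μ)) = ∏ i ∈ s, ∫ a, φ i a ∂μ := by
  induction s using Finset.induction_on with
  | empty => simp
  | insert i s hi ih =>
    have hmeas : Measurable (fun x : ι → α => ∏ j ∈ insert i s, φ j (x j)) :=
      Finset.measurable_prod _ fun j _ => (hm j).comp (measurable_pi_apply j)
    have hint : Integrable (fun x : ι → α => ∏ j ∈ insert i s, φ j (x j))
        (Measure.infinitePi (fun _ : ι => μ)) := by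
      refine Integrable.of_bound hmeas.aestronglyMeasurable 1 (ae_of_all _ fun x => ?_)
      rw [norm_prod]
      exact Finset.prod_le_one (fun i _ => norm_nonneg _) fun i _ => hb _ _
    rw [← integral_resample μ i hint, Finset.prod_insert hi, ← ih, ← integral_const_mul]
    refine integral_congr_ae (ae_of_all _ fun x => ?_)
    simp only
    rw [← integral_mul_const]
    refine integral_congr_ae (ae_of_all _ fun a => ?_)
    simp only
    rw [Finset.prod_insert hi, Function.update_self]
    congr 1
    refine Finset.prod_congr rfl fun j hj => ?_
    rw [Function.update_of_ne (by rintro rfl; exact hi hj)]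

/-- Both quantities are compared with 1 - t² v / 2, where v is the second moment. The error is kept
proportional to v, so that over a row of total variance one the errors add up to the bare prefactor.
-/
lemma norm_charFun_sub_le {f : α → ℝ} (hf : BddMeas f) (h0 : ∫ a, f a ∂μ = 0) {t β : ℝ}
    (hβ : ∀ a, |f a| ≤ β) (ht : |t| * β ≤ 1) :
    ‖∫ a, Complex.exp ((t * f a : ℝ) * Complex.I) ∂μ
        - Complex.exp ((-(t ^ 2 * (∫ a, f a ^ 2 ∂μ) / 2) : ℝ))‖
      ≤ (|t| ^ 3 * β + t ^ 4 * β ^ 2) * ∫ a, f a ^ 2 ∂μ := by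
  set v := ∫ a, f a ^ 2 ∂μ with hv
  have hβ0 : 0 ≤ β := by
    obtain ⟨a⟩ := nonempty_of_isProbabilityMeasure μ
    exact (abs_nonneg _).trans (hβ a)
  have hv0 : 0 ≤ v := integral_nonneg fun a => sq_nonneg _
  have hsqβ : ∀ a, f a ^ 2 ≤ β ^ 2 := fun a => by
    rw [← sq_abs]; exact pow_le_pow_left₀ (abs_nonneg _) (hβ a) 2
  have hvβ : v ≤ β ^ 2 := by
    calc v ≤ ∫ _, β ^ 2 ∂μ := integral_mono (hf.sq.integrable _) (integrable_const _) hsqβ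
      _ = β ^ 2 := by simp
  have hpt : ∀ a, ‖Complex.exp ((t * f a : ℝ) * Complex.I)
      - (1 + (t * f a : ℝ) * Complex.I - ((t ^ 2 * f a ^ 2 / 2 : ℝ) : ℂ))‖
      ≤ |t| ^ 3 * β * f a ^ 2 := by
    intro a
    have hta : |t * f a| ≤ 1 := by
      rw [abs_mul]
      exact (mul_le_mul_of_nonneg_left (hβ a) (abs_nonneg _)).trans ht
    have hn : ‖((t * f a : ℝ) : ℂ) * Complex.I‖ = |t * f a| := by simp
    have h := Complex.exp_bound (x := ((t * f a : ℝ) : ℂ) * Complex.I) (by rw [hn]; exact hta)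
      (n := 3) (by norm_num)
    rw [hn] at h
    have hs : ∑ m ∈ Finset.range 3, (((t * f a : ℝ) : ℂ) * Complex.I) ^ m / (m.factorial : ℂ)
        = 1 + (t * f a : ℝ) * Complex.I - ((t ^ 2 * f a ^ 2 / 2 : ℝ) : ℂ) := by
      simp only [Finset.sum_range_succ, Finset.sum_range_zero]
      norm_num [Nat.factorial]
      rw [mul_pow, Complex.I_sq]
      ring
    rw [hs] at h
    refine h.trans ?_
    have h3 : |t * f a| ^ 3 ≤ |t| ^ 3 * β * f a ^ 2 := by
      rw [abs_mul, mul_pow, mul_assoc]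
      refine mul_le_mul_of_nonneg_left ?_ (by positivity)
      rw [pow_succ, sq_abs, mul_comm]
      exact mul_le_mul_of_nonneg_right (hβ a) (sq_nonneg _)
    have h4 : 0 ≤ |t * f a| ^ 3 := by positivity
    generalize |t * f a| ^ 3 = q at *
    norm_num [Nat.factorial]
    linarith
  have hexpI : Integrable (fun a => Complex.exp ((t * f a : ℝ) * Complex.I)) μ := by
    refine Integrable.of_bound ?_ 1 (ae_of_all _ fun a => ?_)
    · have := hf.1
      exact (by fun_prop : Measurable fun a =>
        Complex.exp ((t * f a : ℝ) * Complex.I)).aestronglyMeasurable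
    · rw [Complex.norm_exp_ofReal_mul_I]
  have hI1 : Integrable (fun a => ((t * f a : ℝ) : ℂ) * Complex.I) μ :=
    ((hf.const_mul t).integrable μ).ofReal.mul_const _
  have hI2 : Integrable (fun a => ((t ^ 2 * f a ^ 2 / 2 : ℝ) : ℂ)) μ :=
    (((hf.sq.const_mul (t ^ 2)).integrable μ).div_const 2).ofReal
  have hI3 : Integrable (fun a => (1 : ℂ) + ((t * f a : ℝ) : ℂ) * Complex.I) μ :=
    (integrable_const _).add hI1
  have hI4 : Integrable (fun a => 1 + (t * f a : ℝ) * Complex.I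
      - ((t ^ 2 * f a ^ 2 / 2 : ℝ) : ℂ)) μ := hI3.sub hI2
  have hpoly : ∫ a, (1 + (t * f a : ℝ) * Complex.I - ((t ^ 2 * f a ^ 2 / 2 : ℝ) : ℂ)) ∂μ
      = ((1 - t ^ 2 * v / 2 : ℝ) : ℂ) := by
    rw [integral_sub hI3 hI2, integral_add (integrable_const _) hI1,
      integral_mul_const, integral_complex_ofReal, integral_complex_ofReal, integral_const_mul, h0,
      integral_div, integral_const_mul, ← hv]
    simp
  have h1 : ‖∫ a, Complex.exp ((t * f a : ℝ) * Complex.I) ∂μ - ((1 - t ^ 2 * v / 2 : ℝ) : ℂ)‖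
      ≤ |t| ^ 3 * β * v := by
    rw [← hpoly, ← integral_sub hexpI hI4]
    refine (norm_integral_le_of_norm_le ((hf.sq.const_mul (|t| ^ 3 * β)).integrable μ)
      (ae_of_all _ hpt)).trans ?_
    rw [integral_const_mul]
  have htv : t ^ 2 * v / 2 ≤ 1 := by
    have : t ^ 2 * v ≤ t ^ 2 * β ^ 2 := mul_le_mul_of_nonneg_left hvβ (sq_nonneg _)
    have h2 : t ^ 2 * β ^ 2 = (|t| * β) ^ 2 := by rw [mul_pow, sq_abs]
    have h3 : (|t| * β) ^ 2 ≤ 1 := pow_le_one₀ (by positivity) ht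
    linarith
  have htv0 : 0 ≤ t ^ 2 * v / 2 := by positivity
  have h2 : ‖((1 - t ^ 2 * v / 2 : ℝ) : ℂ) - Complex.exp ((-(t ^ 2 * v / 2) : ℝ))‖
      ≤ t ^ 4 * β ^ 2 * v := by
    have h := Real.norm_exp_sub_one_sub_id_le (x := -(t ^ 2 * v / 2))
      (by rw [Real.norm_eq_abs, abs_neg, abs_of_nonneg htv0]; exact htv)
    rw [← Complex.ofReal_exp, ← Complex.ofReal_sub, Complex.norm_real, norm_sub_rev]
    have h3 : Real.exp (-(t ^ 2 * v / 2)) - (1 - t ^ 2 * v / 2)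
        = Real.exp (-(t ^ 2 * v / 2)) - 1 - -(t ^ 2 * v / 2) := by ring
    rw [h3]
    refine h.trans ?_
    rw [norm_neg, Real.norm_eq_abs, sq_abs]
    have h4 : t ^ 4 * v * v ≤ t ^ 4 * v * β ^ 2 := mul_le_mul_of_nonneg_left hvβ (by positivity)
    have h5 : 0 ≤ t ^ 4 * v * v := by positivity
    nlinarith
  calc _ ≤ _ := norm_sub_le_norm_sub_add_norm_sub _ ((1 - t ^ 2 * v / 2 : ℝ) : ℂ) _
    _ ≤ |t| ^ 3 * β * v + t ^ 4 * β ^ 2 * v := add_le_add h1 h2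
    _ = _ := by ring

/-- A central limit theorem for triangular arrays of uniformly small bounded summands. -/
theorem tendstoInDistribution_triangular {f : ℕ → ℕ → α → ℝ} (hf : ∀ n i, BddMeas (f n i))
    (h0 : ∀ n i, ∫ a, f n i a ∂μ = 0) {β : ℕ → ℝ} (hβ : ∀ n, ∀ i < n, ∀ a, |f n i a| ≤ β n)
    (hβ0 : Tendsto β atTop (nhds 0))
    (hvar : ∀ᶠ n in atTop, ∑ i ∈ Finset.range n, ∫ a, f n i a ^ 2 ∂μ = 1) :
    TendstoInDistribution (fun (n : ℕ) (x : ℕ → α) => ∑ i ∈ Finset.range n, f n i (x i)) atTop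
      (id : ℝ → ℝ) (fun _ => Measure.infinitePi (fun _ : ℕ => μ)) (gaussianReal 0 1) := by
  have hmeas : ∀ n, Measurable (fun x : ℕ → α => ∑ i ∈ Finset.range n, f n i (x i)) := fun n =>
    Finset.measurable_sum _ fun i _ => (hf n i).1.comp (measurable_pi_apply i)
  refine ⟨fun n => (hmeas n).aemeasurable, aemeasurable_id, ?_⟩
  refine ProbabilityMeasure.tendsto_iff_tendsto_charFun.2 fun t => ?_
  simp only [ProbabilityMeasure.coe_mk, Measure.map_id]
  rw [charFun_gaussianReal]
  have hchar : ∀ n, charFun ((Measure.infinitePi (fun _ : ℕ => μ)).map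
      (fun x : ℕ → α => ∑ i ∈ Finset.range n, f n i (x i))) t
      = ∏ i ∈ Finset.range n, ∫ a, Complex.exp ((t * f n i a : ℝ) * Complex.I) ∂μ := by
    intro n
    rw [charFun_apply_real, integral_map (hmeas n).aemeasurable
      (by fun_prop : Measurable fun y : ℝ => Complex.exp (t * y * Complex.I)).aestronglyMeasurable,
      ← integral_prod_infinitePi μ (Finset.range n)
        (φ := fun i a => Complex.exp ((t * f n i a : ℝ) * Complex.I))
        (fun i => by have := (hf n i).1; fun_prop)
        (fun i a => by rw [Complex.norm_exp_ofReal_mul_I])]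
    congr 1
    ext x
    rw [← Complex.exp_sum]
    congr 1
    push_cast
    rw [Finset.mul_sum, Finset.sum_mul]
  simp_rw [hchar]
  rw [tendsto_iff_norm_sub_tendsto_zero]
  have hlim : Tendsto (fun n => |t| ^ 3 * β n + t ^ 4 * β n ^ 2) atTop (nhds 0) := by
    simpa using (hβ0.const_mul (|t| ^ 3)).add ((hβ0.pow 2).const_mul (t ^ 4))
  have hsmall : ∀ᶠ n in atTop, |t| * β n ≤ 1 := by
    have : Tendsto (fun n => |t| * β n) atTop (nhds 0) := by simpa using hβ0.const_mul |t|
    exact this.eventually_le_const one_pos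
  refine squeeze_zero' (Eventually.of_forall fun n => norm_nonneg _) ?_ hlim
  filter_upwards [hvar, hsmall] with n hn hs
  have hexp : Complex.exp (t * (0 : ℝ) * Complex.I - (1 : NNReal) * t ^ 2 / 2)
      = ∏ i ∈ Finset.range n, Complex.exp ((-(t ^ 2 * (∫ a, f n i a ^ 2 ∂μ) / 2) : ℝ)) := by
    rw [← Complex.exp_sum, ← Complex.ofReal_sum, Finset.sum_neg_distrib, ← Finset.sum_div,
      ← Finset.mul_sum, hn]
    congr 1
    push_cast
    ring
  rw [hexp]
  refine (norm_prod_sub_prod_le _ (fun i _ => ?_) (fun i _ => ?_)).trans ?_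
  · refine (norm_integral_le_of_norm_le_const (C := 1) (ae_of_all _ fun a => ?_)).trans (by simp)
    rw [Complex.norm_exp_ofReal_mul_I]
  · rw [← Complex.ofReal_exp, Complex.norm_real, Real.norm_eq_abs, Real.abs_exp,
      Real.exp_le_one_iff, neg_nonpos]
    have : 0 ≤ ∫ a, f n i a ^ 2 ∂μ := integral_nonneg fun a => sq_nonneg _
    positivity
  · calc _ ≤ ∑ i ∈ Finset.range n, (|t| ^ 3 * β n + t ^ 4 * β n ^ 2) * ∫ a, f n i a ^ 2 ∂μ :=
          Finset.sum_le_sum fun i hi => norm_charFun_sub_le μ (hf n i) (h0 n i)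
            (hβ n i (Finset.mem_range.1 hi)) hs
      _ = _ := by rw [← Finset.mul_sum, hn, mul_one]

end CLT

/-! ### Counting decreasing triples. -/

/-- The decreasing triples of elements of `s`. -/
def triples (s : Finset ℕ) : Finset (ℕ × ℕ × ℕ) :=
  (s ×ˢ s ×ˢ s).filter fun t => t.2.1 < t.1 ∧ t.2.2 < t.2.1

/-- The triple `t` contains the index `i`. -/
def Occurs (i : ℕ) (t : ℕ × ℕ × ℕ) : Prop := i = t.1 ∨ i = t.2.1 ∨ i = t.2.2

instance (i : ℕ) (t : ℕ × ℕ × ℕ) : Decidable (Occurs i t) :=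
  inferInstanceAs (Decidable (_ ∨ _ ∨ _))

lemma sum_triples {M : Type*} [AddCommMonoid M] (s : Finset ℕ) (f : ℕ → ℕ → ℕ → M) :
    ∑ i ∈ s, ∑ j ∈ s with j < i, ∑ k ∈ s with k < j, f i j k
      = ∑ t ∈ triples s, f t.1 t.2.1 t.2.2 := by
  unfold triples
  rw [Finset.sum_filter, Finset.sum_product]
  refine Finset.sum_congr rfl fun i _ => ?_
  rw [Finset.sum_product, Finset.sum_filter]
  refine Finset.sum_congr rfl fun j _ => ?_
  rw [Finset.sum_filter]
  split_ifs with h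
  · simp [h]
  · simp [h]

lemma sum_card_lt (s : Finset ℕ) : ∑ j ∈ s, ∑ k ∈ s with k < j, 1 = s.card.choose 2 := by
  induction s using Finset.induction_on_max with
  | empty => simp
  | insert a s ha ih =>
    have hna : a ∉ s := fun h => lt_irrefl _ (ha a h)
    rw [Finset.sum_insert hna, Finset.card_insert_of_notMem hna]
    have h1 : (insert a s).filter (· < a) = s := by
      ext x; simp only [Finset.mem_filter, Finset.mem_insert]
      exact ⟨fun h => h.1.resolve_left h.2.ne, fun h => ⟨Or.inr h, ha x h⟩⟩
    have h2 : ∀ j ∈ s, (insert a s).filter (· < j) = s.filter (· < j) := by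
      intro j hj
      rw [Finset.filter_insert, if_neg (ha j hj).not_gt]
    have h3 : ∀ j ∈ s, ∑ k ∈ insert a s with k < j, 1 = ∑ k ∈ s with k < j, 1 := fun j hj => by
      rw [h2 j hj]
    rw [h1, Finset.sum_congr rfl h3, ih, Nat.choose_succ_succ]
    simp

/-- A new maximum heads one triple for each decreasing pair below it, so the induction is Pascal's
rule. -/
lemma card_triples (s : Finset ℕ) : (triples s).card = s.card.choose 3 := by
  rw [Finset.card_eq_sum_ones, ← sum_triples s fun _ _ _ => 1]
  induction s using Finset.induction_on_max with
  | empty => simp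
  | insert a s ha ih =>
    have hna : a ∉ s := fun h => lt_irrefl _ (ha a h)
    rw [Finset.sum_insert hna, Finset.card_insert_of_notMem hna]
    have h1 : (insert a s).filter (· < a) = s := by
      ext x; simp only [Finset.mem_filter, Finset.mem_insert]
      exact ⟨fun h => h.1.resolve_left h.2.ne, fun h => ⟨Or.inr h, ha x h⟩⟩
    have h2 : ∀ j ∈ s, (insert a s).filter (· < j) = s.filter (· < j) := by
      intro j hj
      rw [Finset.filter_insert, if_neg (ha j hj).not_gt]
    have h3 : ∀ j ∈ s, ∑ k ∈ insert a s with k < j, 1 = ∑ k ∈ s with k < j, 1 := fun j hj => by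
      rw [h2 j hj]
    have h4 : ∀ i ∈ s, ∑ j ∈ insert a s with j < i, ∑ k ∈ insert a s with k < j, 1
        = ∑ j ∈ s with j < i, ∑ k ∈ s with k < j, 1 := fun i hi => by
      rw [h2 i hi]
      exact Finset.sum_congr rfl fun j hj => h3 j (Finset.mem_filter.1 hj).1
    rw [h1, Finset.sum_congr rfl h4, ih, Finset.sum_congr rfl h3, sum_card_lt,
      Nat.choose_succ_succ s.card 2]

lemma mem_triples {s : Finset ℕ} {t : ℕ × ℕ × ℕ} :
    t ∈ triples s ↔ (t.1 ∈ s ∧ t.2.1 ∈ s ∧ t.2.2 ∈ s) ∧ t.2.1 < t.1 ∧ t.2.2 < t.2.1 := by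
  simp [triples]

lemma triples_erase (s : Finset ℕ) (i : ℕ) :
    triples (s.erase i) = (triples s).filter fun t => ¬Occurs i t := by
  ext ⟨a, b, c⟩
  rw [Finset.mem_filter, mem_triples, mem_triples]
  simp only [Occurs, Finset.mem_erase]
  have : (a ≠ i ↔ ¬ i = a) ∧ (b ≠ i ↔ ¬ i = b) ∧ (c ≠ i ↔ ¬ i = c) := ⟨ne_comm, ne_comm, ne_comm⟩
  tauto

lemma card_occurs {s : Finset ℕ} {t : ℕ × ℕ × ℕ} (ht : t ∈ triples s) :
    (s.filter fun i => Occurs i t).card = 3 := by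
  obtain ⟨⟨h1, h2, h3⟩, h4, h5⟩ := mem_triples.1 ht
  have : s.filter (fun i => Occurs i t) = {t.1, t.2.1, t.2.2} := by
    ext i
    rw [Finset.mem_filter]
    simp only [Finset.mem_insert, Finset.mem_singleton, Occurs]
    refine ⟨fun h => h.2, fun h => ⟨?_, h⟩⟩
    rcases h with rfl | rfl | rfl <;> assumption
  rw [this]
  exact Finset.card_eq_three.2 ⟨_, _, _, by omega, by omega, by omega, rfl⟩

lemma card_triples_range_le (n : ℕ) : (triples (Finset.range n)).card ≤ n ^ 3 := by
  refine (Finset.card_filter_le _ _).trans ?_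
  simp only [Finset.card_product, Finset.card_range]
  exact le_of_eq (by ring)

lemma card_filter_occurs_le {n : ℕ} (i : ℕ) :
    ((triples (Finset.range n)).filter (Occurs i)).card ≤ 3 * n ^ 2 := by
  set R := Finset.range n with hR
  have hsub : (triples R).filter (Occurs i) ⊆
      ({i} ×ˢ R ×ˢ R) ∪ (R ×ˢ {i} ×ˢ R) ∪ (R ×ˢ R ×ˢ {i}) := by
    rintro ⟨a, b, c⟩ h
    rw [Finset.mem_filter, mem_triples] at h
    simp only [Occurs] at h
    simp only [Finset.mem_union, Finset.mem_product, Finset.mem_singleton]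
    have : (i = a ↔ a = i) ∧ (i = b ↔ b = i) ∧ (i = c ↔ c = i) := ⟨eq_comm, eq_comm, eq_comm⟩
    tauto
  refine (Finset.card_le_card hsub).trans ((Finset.card_union_le _ _).trans
    ((Nat.add_le_add_right (Finset.card_union_le _ _) _).trans ?_))
  simp only [Finset.card_product, Finset.card_singleton, hR, Finset.card_range]
  exact le_of_eq (by ring)

/-- There are six ways to place `i` and `j`, with at most `n` choices for the third entry. This
linear count makes `partialTotal n i`, of size n², insensitive to any other single observation. -/
lemma card_filter_occurs_occurs_le {n i j : ℕ} (hij : i ≠ j) :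
    ((triples (Finset.range n)).filter fun t => Occurs i t ∧ Occurs j t).card ≤ 6 * n := by
  set R := Finset.range n with hR
  have hsub : ((triples R).filter fun t => Occurs i t ∧ Occurs j t) ⊆
      (({i} ×ˢ {j} ×ˢ R) ∪ ({i} ×ˢ R ×ˢ {j})) ∪ (({j} ×ˢ {i} ×ˢ R) ∪ ({j} ×ˢ R ×ˢ {i})) ∪
        ((R ×ˢ {i} ×ˢ {j}) ∪ (R ×ˢ {j} ×ˢ {i})) := by
    rintro ⟨a, b, c⟩ h
    rw [Finset.mem_filter, mem_triples] at h
    simp only [Occurs] at h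
    simp only [Finset.mem_union, Finset.mem_product, Finset.mem_singleton]
    obtain ⟨⟨⟨h1, h2, h3⟩, -⟩, h4, h5⟩ := h
    rcases h4 with rfl | rfl | rfl <;> rcases h5 with rfl | rfl | rfl <;> simp_all
  refine (Finset.card_le_card hsub).trans ((Finset.card_union_le _ _).trans
    ((Nat.add_le_add ((Finset.card_union_le _ _).trans (Nat.add_le_add (Finset.card_union_le _ _)
      (Finset.card_union_le _ _))) (Finset.card_union_le _ _)).trans ?_))
  simp only [Finset.card_product, Finset.card_singleton, hR, Finset.card_range]
  exact le_of_eq (by ring)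

/-! ### Kernel sums and the pseudo-values. -/

/-- The centred kernel. -/
noncomputable def kern (a b c : ℝ) : ℝ := ind a b c - 1 / 2

lemma abs_kern_le (a b c : ℝ) : |kern a b c| ≤ 1 := by
  unfold kern
  rw [abs_le]
  constructor <;> linarith [ind_nonneg a b c, ind_le_one a b c]

lemma measurable_kern : Measurable (fun p : ℝ × ℝ × ℝ => kern p.1 p.2.1 p.2.2) :=
  measurable_ind.sub_const _

/-- The centred kernel at the observations with indices `t`. -/
noncomputable def kernAt (t : ℕ × ℕ × ℕ) (x : ℕ → ℝ) : ℝ := kern (x t.1) (x t.2.1) (x t.2.2)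

lemma abs_kernAt_le (t : ℕ × ℕ × ℕ) (x : ℕ → ℝ) : |kernAt t x| ≤ 1 := abs_kern_le _ _ _

lemma bddMeas_kernAt (t : ℕ × ℕ × ℕ) : BddMeas (kernAt t) :=
  ⟨measurable_kern.comp (by fun_prop : Measurable fun x : ℕ → ℝ => (x t.1, x t.2.1, x t.2.2)),
    1, abs_kernAt_le t⟩

lemma kernAt_update {t : ℕ × ℕ × ℕ} {i : ℕ} (h : ¬Occurs i t) (x : ℕ → ℝ) (a : ℝ) :
    kernAt t (Function.update x i a) = kernAt t x := by
  simp only [Occurs, not_or] at h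
  unfold kernAt
  rw [Function.update_of_ne (Ne.symm h.1), Function.update_of_ne (Ne.symm h.2.1),
    Function.update_of_ne (Ne.symm h.2.2)]

/-- The sum of the centred kernel over all triples of the first `n` observations. -/
noncomputable def total (n : ℕ) (x : ℕ → ℝ) : ℝ := ∑ t ∈ triples (Finset.range n), kernAt t x

/-- The sum of the centred kernel over the triples of the first `n` observations that contain the
`i`-th one. -/
noncomputable def partialTotal (n i : ℕ) (x : ℕ → ℝ) : ℝ :=
  ∑ t ∈ triples (Finset.range n) with Occurs i t, kernAt t x

lemma bddMeas_total (n : ℕ) : BddMeas (total n) := BddMeas.sum fun t _ => bddMeas_kernAt t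

lemma bddMeas_partialTotal (n i : ℕ) : BddMeas (partialTotal n i) :=
  BddMeas.sum fun t _ => bddMeas_kernAt t

lemma abs_sum_kernAt_le (s : Finset (ℕ × ℕ × ℕ)) (x : ℕ → ℝ) :
    |∑ t ∈ s, kernAt t x| ≤ s.card := by
  refine (Finset.abs_sum_le_sum_abs _ _).trans ?_
  refine (Finset.sum_le_sum fun t _ => abs_kernAt_le t x).trans ?_
  simp

lemma abs_total_le (n : ℕ) (x : ℕ → ℝ) : |total n x| ≤ (n : ℝ) ^ 3 :=
  (abs_sum_kernAt_le _ x).trans (by exact_mod_cast card_triples_range_le n)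

lemma abs_partialTotal_le (n i : ℕ) (x : ℕ → ℝ) : |partialTotal n i x| ≤ 3 * (n : ℝ) ^ 2 :=
  (abs_sum_kernAt_le _ x).trans (by exact_mod_cast card_filter_occurs_le i)

lemma total_sub_partialTotal (n i : ℕ) (x : ℕ → ℝ) :
    total n x - partialTotal n i x
      = ∑ t ∈ triples (Finset.range n) with ¬Occurs i t, kernAt t x := by
  unfold total partialTotal
  rw [← Finset.sum_filter_add_sum_filter_not _ (Occurs i)]
  ring

/-- Triples that avoid `i` do not see the change. -/
lemma total_sub_total_update (n i : ℕ) (x : ℕ → ℝ) (a : ℝ) :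
    total n x - total n (Function.update x i a)
      = partialTotal n i x - partialTotal n i (Function.update x i a) := by
  have h1 := total_sub_partialTotal n i x
  have h2 := total_sub_partialTotal n i (Function.update x i a)
  have h3 : ∑ t ∈ triples (Finset.range n) with ¬Occurs i t, kernAt t (Function.update x i a)
      = ∑ t ∈ triples (Finset.range n) with ¬Occurs i t, kernAt t x :=
    Finset.sum_congr rfl fun t ht => kernAt_update (Finset.mem_filter.1 ht).2 x a
  linarith

lemma abs_partialTotal_sub_update_le {n i j : ℕ} (hij : i ≠ j) (x : ℕ → ℝ) (b : ℝ) :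
    |partialTotal n i x - partialTotal n i (Function.update x j b)| ≤ 12 * n := by
  have h1 : partialTotal n i x - partialTotal n i (Function.update x j b)
      = ∑ t ∈ triples (Finset.range n) with Occurs i t ∧ Occurs j t,
        (kernAt t x - kernAt t (Function.update x j b)) := by
    unfold partialTotal
    rw [← Finset.sum_sub_distrib, ← Finset.filter_filter, Finset.sum_filter _ _]
    conv_rhs => rw [Finset.sum_filter]
    rw [← Finset.sum_filter]
    refine Finset.sum_congr rfl fun t _ => ?_
    split_ifs with h
    · rfl
    · rw [kernAt_update h, sub_self]
  rw [h1]
  refine (Finset.abs_sum_le_sum_abs _ _).trans ?_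
  have h2 : ∀ t, |kernAt t x - kernAt t (Function.update x j b)| ≤ 2 := fun t =>
    (abs_sub _ _).trans (by linarith [abs_kernAt_le t x, abs_kernAt_le t (Function.update x j b)])
  refine (Finset.sum_le_sum fun t _ => h2 t).trans ?_
  have h3 : (((triples (Finset.range n)).filter fun t => Occurs i t ∧ Occurs j t).card : ℝ)
      ≤ 6 * n := by exact_mod_cast card_filter_occurs_occurs_le hij
  rw [Finset.sum_const, nsmul_eq_mul]
  linarith

lemma sum_partialTotal (n : ℕ) (x : ℕ → ℝ) :
    ∑ i ∈ Finset.range n, partialTotal n i x = 3 * total n x := by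
  unfold partialTotal total
  simp_rw [Finset.sum_filter]
  rw [Finset.sum_comm, Finset.mul_sum]
  refine Finset.sum_congr rfl fun t ht => ?_
  rw [← Finset.sum_filter, Finset.sum_const, card_occurs ht]
  simp

lemma dependsOn_total (n : ℕ) : DependsOn (total n) (Finset.range n : Set ℕ) := by
  intro x y hxy
  refine Finset.sum_congr rfl fun t ht => ?_
  obtain ⟨⟨h1, h2, h3⟩, -⟩ := mem_triples.1 ht
  unfold kernAt
  rw [hxy _ h1, hxy _ h2, hxy _ h3]

lemma dependsOn_partialTotal (n i : ℕ) :
    DependsOn (partialTotal n i) (Finset.range n : Set ℕ) := by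
  intro x y hxy
  refine Finset.sum_congr rfl fun t ht => ?_
  obtain ⟨⟨h1, h2, h3⟩, -⟩ := mem_triples.1 (Finset.mem_filter.1 ht).1
  unfold kernAt
  rw [hxy _ h1, hxy _ h2, hxy _ h3]

lemma deltaStar_eq {s : Finset ℕ} (hs : 3 ≤ s.card) (x : ℕ → ℝ) :
    deltaStar s x = ((s.card.choose 3 : ℕ) : ℝ)⁻¹ * ∑ t ∈ triples s, kernAt t x := by
  unfold deltaStar
  have hc : ((s.card.choose 3 : ℕ) : ℝ) ≠ 0 := by
    exact_mod_cast (Nat.choose_pos hs).ne'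
  have h1 : ∑ t ∈ triples s, kernAt t x = ∑ t ∈ triples s, ind (x t.1) (x t.2.1) (x t.2.2)
      - ((s.card.choose 3 : ℕ) : ℝ) * (1 / 2) := by
    rw [← card_triples s]
    unfold kernAt kern
    rw [Finset.sum_sub_distrib, Finset.sum_const, nsmul_eq_mul]
  rw [sum_triples s fun i j k => ind (x i) (x j) (x k), h1, mul_sub, ← mul_assoc,
    inv_mul_cancel₀ hc, one_mul]

lemma cast_choose_three {n : ℕ} (hn : 2 ≤ n) :
    ((n.choose 3 : ℕ) : ℝ) = (n : ℝ) * (n - 1) * (n - 2) / 6 := by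
  obtain ⟨m, rfl⟩ := Nat.exists_eq_add_of_le hn
  have h := Nat.descFactorial_eq_factorial_mul_choose (2 + m) 3
  have h' : ((2 + m).descFactorial 3 : ℝ) = (3).factorial * ((2 + m).choose 3 : ℝ) := by
    exact_mod_cast h
  have e1 : 2 + m - 2 = m := by omega
  have e2 : 2 + m - 1 = m + 1 := by omega
  simp only [Nat.descFactorial, Nat.sub_zero, e1, e2, mul_one] at h'
  norm_num [Nat.factorial] at h'
  push_cast
  linarith

/-- Deleting an observation removes exactly the triples through it, so both statistics are
combinations of `total` and `partialTotal`. The bound 4 ≤ n keeps the binomial coefficient of n - 1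
nonzero. -/
lemma pseudoValue_eq {n : ℕ} (hn : 4 ≤ n) {i : ℕ} (hi : i < n) (x : ℕ → ℝ) :
    pseudoValue n x i = 6 / (((n : ℝ) - 2) * (n - 3)) * partialTotal n i x
      - 12 / (((n : ℝ) - 1) * (n - 2) * (n - 3)) * total n x := by
  have hcard : ((Finset.range n).erase i).card = n - 1 := by
    rw [Finset.card_erase_of_mem (Finset.mem_range.2 hi), Finset.card_range]
  unfold pseudoValue
  rw [deltaStar_eq (by simp; omega), deltaStar_eq (by rw [hcard]; omega), hcard, triples_erase,
    ← total_sub_partialTotal, Finset.card_range, cast_choose_three (by omega),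
    cast_choose_three (n := n - 1) (by omega), Nat.cast_sub (by omega)]
  have hn' : (4 : ℝ) ≤ n := by exact_mod_cast hn
  have h0 : (n : ℝ) ≠ 0 := by linarith
  have h1 : (n : ℝ) - 1 ≠ 0 := by linarith
  have h2 : (n : ℝ) - 2 ≠ 0 := by linarith
  have h3 : (n : ℝ) - 3 ≠ 0 := by linarith
  have e2 : (n : ℝ) - (1 : ℕ) - 1 = n - 2 := by push_cast; ring
  have e3 : (n : ℝ) - (1 : ℕ) - 2 = n - 3 := by push_cast; ring
  rw [e2, e3]
  change _ * (_ * total n x) - _ = _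
  push_cast
  field_simp
  ring

/-- The coefficient is n divided by the binomial coefficient of n over 3: the mean of the
pseudo-values is the statistic itself. -/
lemma sum_pseudoValue {n : ℕ} (hn : 4 ≤ n) (x : ℕ → ℝ) :
    ∑ i ∈ Finset.range n, pseudoValue n x i = 6 / (((n : ℝ) - 1) * (n - 2)) * total n x := by
  rw [Finset.sum_congr rfl fun i hi => pseudoValue_eq hn (Finset.mem_range.1 hi) x,
    Finset.sum_sub_distrib, ← Finset.mul_sum, sum_partialTotal, Finset.sum_const,
    Finset.card_range, nsmul_eq_mul]
  have hn' : (4 : ℝ) ≤ n := by exact_mod_cast hn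
  have h1 : (n : ℝ) - 1 ≠ 0 := by linarith
  have h2 : (n : ℝ) - 2 ≠ 0 := by linarith
  have h3 : (n : ℝ) - 3 ≠ 0 := by linarith
  field_simp
  ring

/-! ### Projection onto single observations and second moments. -/

section Moments

variable (μ : Measure ℝ) [IsProbabilityMeasure μ]

lemma integral_eval_infinitePi {f : ℝ → ℝ} (hf : BddMeas f) (i : ℕ) :
    ∫ x, f (x i) ∂(Measure.infinitePi (fun _ : ℕ => μ)) = ∫ a, f a ∂μ := by
  rw [← integral_resample μ i ((hf.comp (measurable_pi_apply i)).integrable _)]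
  simp

lemma integral_eval₂_infinitePi {f : ℝ × ℝ → ℝ} (hf : BddMeas f) {i j : ℕ} (hij : i ≠ j) :
    ∫ x, f (x i, x j) ∂(Measure.infinitePi (fun _ : ℕ => μ)) = ∫ a, ∫ b, f (a, b) ∂μ ∂μ := by
  have hb : BddMeas (fun x : ℕ → ℝ => f (x i, x j)) :=
    hf.comp ((measurable_pi_apply i).prodMk (measurable_pi_apply j))
  rw [← integral_resample μ j (hb.integrable _),
    ← integral_eval_infinitePi μ (hf.integral_right μ) i]
  simp [Function.update_of_ne hij]

/-- The conditional mean of the centred kernel given its first argument. -/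
noncomputable def firstProj (a : ℝ) : ℝ := ∫ b, ∫ c, kern a b c ∂μ ∂μ

lemma bddMeas_kern₂ : BddMeas (fun p : ℝ × ℝ => ∫ c, kern p.1 p.2 c ∂μ) := by
  have h : BddMeas (fun p : (ℝ × ℝ) × ℝ => kern p.1.1 p.1.2 p.2) :=
    ⟨measurable_kern.comp (by fun_prop : Measurable fun p : (ℝ × ℝ) × ℝ => (p.1.1, p.1.2, p.2)),
      1, fun p => abs_kern_le _ _ _⟩
  exact h.integral_right μ

lemma bddMeas_firstProj : BddMeas (firstProj μ) := (bddMeas_kern₂ μ).integral_right μ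

lemma integral_kernAt {s : Finset ℕ} {t : ℕ × ℕ × ℕ} (ht : t ∈ triples s) :
    ∫ x, kernAt t x ∂(Measure.infinitePi (fun _ : ℕ => μ)) = ∫ a, firstProj μ a ∂μ := by
  obtain ⟨-, h4, h5⟩ := mem_triples.1 ht
  rw [← integral_resample μ t.2.2 ((bddMeas_kernAt t).integrable _)]
  have := integral_eval₂_infinitePi μ (bddMeas_kern₂ μ) (show t.1 ≠ t.2.1 by omega)
  unfold firstProj
  rw [← this]
  unfold kernAt
  simp [Function.update_of_ne (show t.1 ≠ t.2.2 by omega),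
    Function.update_of_ne (show t.2.1 ≠ t.2.2 by omega)]

/-- The first entry of a triple is its largest index and fills the first slot of the kernel, which
is why `firstProj` appears. -/
lemma integral_kernAt_update {s : Finset ℕ} {t : ℕ × ℕ × ℕ} (ht : t ∈ triples s) (a : ℝ) :
    ∫ x, kernAt t (Function.update x t.1 a) ∂(Measure.infinitePi (fun _ : ℕ => μ))
      = firstProj μ a := by
  obtain ⟨-, h4, h5⟩ := mem_triples.1 ht
  have hb : BddMeas (fun p : ℝ × ℝ => kern a p.1 p.2) :=
    ⟨measurable_kern.comp (by fun_prop : Measurable fun p : ℝ × ℝ => (a, p.1, p.2)),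
      1, fun p => abs_kern_le _ _ _⟩
  have := integral_eval₂_infinitePi μ hb (show t.2.1 ≠ t.2.2 by omega)
  unfold firstProj
  rw [← this]
  unfold kernAt
  simp [Function.update_of_ne (show t.2.2 ≠ t.1 by omega),
    Function.update_of_ne (show t.2.1 ≠ t.1 by omega)]

/-- The conditional mean of `partialTotal n i` given the `i`-th observation. -/
noncomputable def proj (n i : ℕ) (a : ℝ) : ℝ :=
  ∫ x, partialTotal n i (Function.update x i a) ∂(Measure.infinitePi (fun _ : ℕ => μ))

lemma bddMeas_proj (n i : ℕ) : BddMeas (proj μ n i) :=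
  (((bddMeas_partialTotal n i).update i).comp measurable_swap).integral_right
    (Measure.infinitePi (fun _ : ℕ => μ))

lemma abs_proj_le (n i : ℕ) (a : ℝ) : |proj μ n i a| ≤ 3 * (n : ℝ) ^ 2 := by
  have := norm_integral_le_of_norm_le_const (μ := Measure.infinitePi (fun _ : ℕ => μ))
    (f := fun x => partialTotal n i (Function.update x i a))
    (ae_of_all _ fun x => abs_partialTotal_le n i _)
  simpa [proj] using this

lemma integral_total (h0 : ∫ a, firstProj μ a ∂μ = 0) (n : ℕ) :
    ∫ x, total n x ∂(Measure.infinitePi (fun _ : ℕ => μ)) = 0 := by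
  unfold total
  rw [integral_finsetSum _ fun t _ => (bddMeas_kernAt t).integrable _]
  exact Finset.sum_eq_zero fun t ht => by rw [integral_kernAt μ ht, h0]

lemma integral_proj (h0 : ∫ a, firstProj μ a ∂μ = 0) (n i : ℕ) : ∫ a, proj μ n i a ∂μ = 0 := by
  have hb := (bddMeas_partialTotal n i).update i
  unfold proj
  rw [integral_integral_swap ((hb.comp measurable_swap).integrable
      (μ.prod (Measure.infinitePi (fun _ : ℕ => μ)))),
    integral_resample μ i ((bddMeas_partialTotal n i).integrable _)]
  unfold partialTotal
  rw [integral_finsetSum _ fun t _ => (bddMeas_kernAt t).integrable _]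
  exact Finset.sum_eq_zero fun t ht => by
    rw [integral_kernAt μ (Finset.mem_filter.1 ht).1, h0]

/-- With the i-th observation frozen, `proj` is the mean. Each of the n other coordinates has
influence at most (12 n)², and Efron–Stein gives n · 144 n². -/
lemma integral_partialTotal_sub_proj_sq_le (n i : ℕ) :
    ∫ x, (partialTotal n i x - proj μ n i (x i)) ^ 2 ∂(Measure.infinitePi (fun _ : ℕ => μ))
      ≤ 144 * (n : ℝ) ^ 3 := by
  have hp := bddMeas_partialTotal n i
  have hP := bddMeas_proj μ n i
  have hb : BddMeas (fun x : ℕ → ℝ => (partialTotal n i x - proj μ n i (x i)) ^ 2) :=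
    (hp.sub (hP.comp (measurable_pi_apply i))).sq
  have hb2 : BddMeas (fun p : (ℕ → ℝ) × ℝ =>
      (partialTotal n i (Function.update p.1 i p.2) - proj μ n i p.2) ^ 2) :=
    ((hp.update i).sub (hP.comp measurable_snd)).sq
  rw [← integral_resample μ i (hb.integrable _)]
  simp only [Function.update_self]
  rw [integral_integral_swap (hb2.integrable ((Measure.infinitePi (fun _ : ℕ => μ)).prod μ))]
  have hfix : ∀ a, ∫ x, (partialTotal n i (Function.update x i a) - proj μ n i a) ^ 2
      ∂(Measure.infinitePi (fun _ : ℕ => μ)) ≤ 144 * (n : ℝ) ^ 3 := by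
    intro a
    have hF : BddMeas (fun x : ℕ → ℝ => partialTotal n i (Function.update x i a)) :=
      hp.update_left i a
    have hdep : DependsOn (fun x : ℕ → ℝ => partialTotal n i (Function.update x i a))
        (Finset.range n : Set ℕ) := by
      intro x y hxy
      refine dependsOn_partialTotal n i fun j hj => ?_
      by_cases hji : j = i
      · subst hji; simp
      · simp [Function.update_of_ne hji, hxy j hj]
    refine (efron_stein μ (Finset.range n) hF hdep).trans ?_
    have hinf : ∀ j ∈ Finset.range n, influence μ
        (fun x : ℕ → ℝ => partialTotal n i (Function.update x i a)) j ≤ (12 * (n : ℝ)) ^ 2 := by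
      intro j _
      refine influence_le μ hF fun x b => ?_
      by_cases hji : j = i
      · subst hji
        simp
      · rw [Function.update_comm hji]
        exact abs_partialTotal_sub_update_le (Ne.symm hji) _ _
    refine (Finset.sum_le_sum hinf).trans (le_of_eq ?_)
    simp
    ring
  calc _ ≤ ∫ _, 144 * (n : ℝ) ^ 3 ∂μ :=
        integral_mono (((hb2.comp measurable_swap).integral_right
          (Measure.infinitePi (fun _ : ℕ => μ))).integrable _) (integrable_const _) hfix
    _ = _ := by simp

/-- The sum of the projections of `total n` onto the single observations. -/
noncomputable def projSum (n : ℕ) (x : ℕ → ℝ) : ℝ := ∑ i ∈ Finset.range n, proj μ n i (x i)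

lemma bddMeas_projSum (n : ℕ) : BddMeas (projSum μ n) :=
  BddMeas.sum fun i _ => (bddMeas_proj μ n i).comp (measurable_pi_apply i)

lemma sum_eval_sub_update {n i : ℕ} (hi : i ∈ Finset.range n) (f : ℕ → ℝ → ℝ) (x : ℕ → ℝ) (a : ℝ) :
    ∑ j ∈ Finset.range n, f j (x j) - ∑ j ∈ Finset.range n, f j (Function.update x i a j)
      = f i (x i) - f i a := by
  rw [← Finset.sum_sub_distrib, Finset.sum_eq_single i]
  · simp
  · intro j _ hji
    simp [Function.update_of_ne hji]
  · exact fun h => absurd hi h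

lemma dependsOn_sum_eval (n : ℕ) (f : ℕ → ℝ → ℝ) :
    DependsOn (fun x : ℕ → ℝ => ∑ j ∈ Finset.range n, f j (x j)) (Finset.range n : Set ℕ) :=
  fun x y hxy => Finset.sum_congr rfl fun j hj => by rw [hxy j hj]

lemma integral_projSum (h0 : ∫ a, firstProj μ a ∂μ = 0) (n : ℕ) :
    ∫ x, projSum μ n x ∂(Measure.infinitePi (fun _ : ℕ => μ)) = 0 := by
  unfold projSum
  rw [integral_finsetSum _ fun i _ =>
    ((bddMeas_proj μ n i).comp (measurable_pi_apply i)).integrable _]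
  exact Finset.sum_eq_zero fun i _ => by
    rw [integral_eval_infinitePi μ (bddMeas_proj μ n i), integral_proj μ h0]

/-- Resampling observation `i` changes this difference exactly as it changes `partialTotal n i -
proj μ n i`. Its influence is therefore at most four times the previous second moment, hence of
order n³. The resulting n⁴ is one order below the n⁵ of the projection. -/
lemma integral_total_sub_projSum_sq_le (h0 : ∫ a, firstProj μ a ∂μ = 0) (n : ℕ) :
    ∫ x, (total n x - projSum μ n x) ^ 2 ∂(Measure.infinitePi (fun _ : ℕ => μ))
      ≤ 576 * (n : ℝ) ^ 4 := by
  set Q := Measure.infinitePi (fun _ : ℕ => μ) with hQ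
  have hF : BddMeas (fun x => total n x - projSum μ n x) :=
    (bddMeas_total n).sub (bddMeas_projSum μ n)
  have hdep : DependsOn (fun x => total n x - projSum μ n x) (Finset.range n : Set ℕ) :=
    fun x y hxy => by
      beta_reduce
      rw [dependsOn_total n hxy, show projSum μ n x = projSum μ n y from
        dependsOn_sum_eval n (proj μ n) hxy]
  have hmean : ∫ x, (total n x - projSum μ n x) ∂Q = 0 := by
    rw [integral_sub ((bddMeas_total n).integrable _) ((bddMeas_projSum μ n).integrable _),
      integral_total μ h0, integral_projSum μ h0, sub_zero]
  have hes := efron_stein μ (Finset.range n) hF hdep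
  rw [← hQ, hmean] at hes
  simp only [sub_zero] at hes
  refine hes.trans ?_
  have hinf : ∀ i ∈ Finset.range n, influence μ (fun x => total n x - projSum μ n x) i
      ≤ 576 * (n : ℝ) ^ 3 := by
    intro i hi
    set D : (ℕ → ℝ) → ℝ := fun x => partialTotal n i x - proj μ n i (x i) with hD
    have hDb : BddMeas D :=
      (bddMeas_partialTotal n i).sub ((bddMeas_proj μ n i).comp (measurable_pi_apply i))
    have hDi : ∫ x, D x ^ 2 ∂Q ≤ 144 * (n : ℝ) ^ 3 := integral_partialTotal_sub_proj_sq_le μ n i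
    have hpt : ∀ x a, ((total n x - projSum μ n x) - (total n (Function.update x i a)
        - projSum μ n (Function.update x i a))) ^ 2
        ≤ 2 * D x ^ 2 + 2 * D (Function.update x i a) ^ 2 := by
      intro x a
      have h1 := total_sub_total_update n i x a
      have h2 : projSum μ n x - projSum μ n (Function.update x i a)
          = proj μ n i (x i) - proj μ n i a := sum_eval_sub_update hi (proj μ n) x a
      have h3 : (total n x - projSum μ n x) - (total n (Function.update x i a)
          - projSum μ n (Function.update x i a)) = D x - D (Function.update x i a) := by
        simp only [hD, Function.update_self]
        linarith
      rw [h3]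
      nlinarith [sq_nonneg (D x + D (Function.update x i a))]
    have hb1 : BddMeas (fun p : (ℕ → ℝ) × ℝ => 2 * D p.1 ^ 2 + 2 * D (Function.update p.1 i p.2) ^ 2) :=
      ((hDb.comp measurable_fst).sq.const_mul 2).add ((hDb.update i).sq.const_mul 2)
    have hb2 : BddMeas (fun p : (ℕ → ℝ) × ℝ => ((total n p.1 - projSum μ n p.1)
        - (total n (Function.update p.1 i p.2) - projSum μ n (Function.update p.1 i p.2))) ^ 2) :=
      ((hF.comp measurable_fst).sub (hF.update i)).sq
    calc _ ≤ ∫ x, ∫ a, (2 * D x ^ 2 + 2 * D (Function.update x i a) ^ 2) ∂μ ∂Q := by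
          refine integral_mono ((hb2.integral_right μ).integrable _)
            ((hb1.integral_right μ).integrable _) fun x => ?_
          exact integral_mono ((((BddMeas.const _).sub (hF.update_right i x)).sq).integrable _)
            (((BddMeas.const _).add ((hDb.update_right i x).sq.const_mul 2)).integrable _)
            fun a => hpt x a
      _ = ∫ x, (2 * D x ^ 2 + 2 * ∫ a, D (Function.update x i a) ^ 2 ∂μ) ∂Q := by
          congr 1
          ext x
          rw [integral_add (integrable_const _)
            (((hDb.update_right i x).sq.const_mul 2).integrable _)]
          simp [integral_const_mul]
      _ = 2 * ∫ x, D x ^ 2 ∂Q + 2 * ∫ x, D x ^ 2 ∂Q := by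
          rw [integral_add ((hDb.sq.const_mul 2).integrable _)
            ((((hDb.update i).sq.integral_right μ).const_mul 2).integrable _),
            integral_const_mul, integral_const_mul, integral_resample μ i (hDb.sq.integrable _)]
      _ ≤ _ := by linarith
  refine (Finset.sum_le_sum hinf).trans (le_of_eq ?_)
  simp
  ring

lemma integral_projSum_sq_le (h0 : ∫ a, firstProj μ a ∂μ = 0) (n : ℕ) :
    ∫ x, projSum μ n x ^ 2 ∂(Measure.infinitePi (fun _ : ℕ => μ)) ≤ 36 * (n : ℝ) ^ 5 := by
  have hes := efron_stein μ (Finset.range n) (bddMeas_projSum μ n)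
    (dependsOn_sum_eval n (proj μ n))
  rw [integral_projSum μ h0] at hes
  simp only [sub_zero] at hes
  refine hes.trans ?_
  have hinf : ∀ i ∈ Finset.range n, influence μ (projSum μ n) i ≤ (6 * (n : ℝ) ^ 2) ^ 2 := by
    intro i hi
    refine influence_le μ (bddMeas_projSum μ n) fun x a => ?_
    have h2 : projSum μ n x - projSum μ n (Function.update x i a)
        = proj μ n i (x i) - proj μ n i a := sum_eval_sub_update hi (proj μ n) x a
    rw [h2]
    exact (abs_sub _ _).trans (by linarith [abs_proj_le μ n i (x i), abs_proj_le μ n i a])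
  refine (Finset.sum_le_sum hinf).trans (le_of_eq ?_)
  simp
  ring

/-- Since (u + v)² ≤ 2 u² + 2 v², the constant is 2 · 576 + 2 · 36 = 1224. -/
lemma integral_total_sq_le (h0 : ∫ a, firstProj μ a ∂μ = 0) {n : ℕ} (hn : 1 ≤ n) :
    ∫ x, total n x ^ 2 ∂(Measure.infinitePi (fun _ : ℕ => μ)) ≤ 1224 * (n : ℝ) ^ 5 := by
  set Q := Measure.infinitePi (fun _ : ℕ => μ) with hQ
  have hF : BddMeas (fun x => total n x - projSum μ n x) :=
    (bddMeas_total n).sub (bddMeas_projSum μ n)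
  have h1 := integral_total_sub_projSum_sq_le μ h0 n
  have h2 := integral_projSum_sq_le μ h0 n
  have h3 : ∫ x, total n x ^ 2 ∂Q
      ≤ ∫ x, (2 * (total n x - projSum μ n x) ^ 2 + 2 * projSum μ n x ^ 2) ∂Q := by
    refine integral_mono ((bddMeas_total n).sq.integrable _)
      (((hF.sq.const_mul 2).add ((bddMeas_projSum μ n).sq.const_mul 2)).integrable _) fun x => ?_
    nlinarith [sq_nonneg (total n x - 2 * projSum μ n x)]
  rw [integral_add ((hF.sq.const_mul 2).integrable _)
    (((bddMeas_projSum μ n).sq.const_mul 2).integrable _), integral_const_mul,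
    integral_const_mul] at h3
  have h4 : (n : ℝ) ^ 4 ≤ (n : ℝ) ^ 5 := pow_le_pow_right₀ (by exact_mod_cast hn) (by norm_num)
  linarith

end Moments

/-! ### Bounds on coefficients and pseudo-values. -/

lemma six_div_sub_le {N : ℝ} (hN : 6 ≤ N) : |6 / ((N - 2) * (N - 3)) - 6 / N ^ 2| ≤ 90 / N ^ 3 := by
  have h0 : 0 < N := by linarith
  have h2 : 0 < N - 2 := by linarith
  have h3 : 0 < N - 3 := by linarith
  have h : 6 / ((N - 2) * (N - 3)) - 6 / N ^ 2
      = 6 * (5 * N - 6) / (N ^ 2 * ((N - 2) * (N - 3))) := by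
    field_simp; ring
  have hq : N ^ 2 ≤ 3 * ((N - 2) * (N - 3)) := by nlinarith
  rw [h, abs_of_nonneg (div_nonneg (by linarith) (by positivity)),
    div_le_div_iff₀ (by positivity) (by positivity)]
  have h5 : 0 ≤ N ^ 2 := by positivity
  calc 6 * (5 * N - 6) * N ^ 3 ≤ 30 * N * N ^ 3 :=
        mul_le_mul_of_nonneg_right (by linarith) (by positivity)
    _ = 30 * N ^ 2 * N ^ 2 := by ring
    _ ≤ 30 * N ^ 2 * (3 * ((N - 2) * (N - 3))) := mul_le_mul_of_nonneg_left hq (by positivity)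
    _ = _ := by ring

lemma six_div_le {N : ℝ} (hN : 6 ≤ N) : |6 / ((N - 2) * (N - 3))| ≤ 18 / N ^ 2 := by
  have h0 : 0 < N := by linarith
  have h2 : 0 < N - 2 := by linarith
  have h3 : 0 < N - 3 := by linarith
  rw [abs_of_nonneg (by positivity), div_le_div_iff₀ (by positivity) (by positivity)]
  nlinarith

lemma twelve_div_le {N : ℝ} (hN : 6 ≤ N) : |12 / ((N - 1) * (N - 2) * (N - 3))| ≤ 48 / N ^ 3 := by
  have h0 : 0 < N := by linarith
  have h1 : 0 < N - 1 := by linarith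
  have h2 : 0 < N - 2 := by linarith
  have h3 : 0 < N - 3 := by linarith
  have hq : N ^ 2 ≤ 3 * ((N - 2) * (N - 3)) := by nlinarith
  rw [abs_of_nonneg (by positivity), div_le_div_iff₀ (by positivity) (by positivity)]
  have h4 : 5 * N * N ^ 2 ≤ 6 * (N - 1) * (3 * ((N - 2) * (N - 3))) :=
    mul_le_mul (by linarith) hq (by positivity) (by linarith)
  have h5 : 0 ≤ N ^ 3 := by positivity
  nlinarith

lemma six_div_sub_le' {N : ℝ} (hN : 6 ≤ N) : |6 / ((N - 1) * (N - 2)) - 6 / N ^ 2| ≤ 36 / N ^ 3 := by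
  have h0 : 0 < N := by linarith
  have h1 : 0 < N - 1 := by linarith
  have h2 : 0 < N - 2 := by linarith
  have h : 6 / ((N - 1) * (N - 2)) - 6 / N ^ 2
      = 6 * (3 * N - 2) / (N ^ 2 * ((N - 1) * (N - 2))) := by
    field_simp; ring
  have hq : N ^ 2 ≤ 2 * ((N - 1) * (N - 2)) := by nlinarith
  rw [h, abs_of_nonneg (div_nonneg (by linarith) (by positivity)),
    div_le_div_iff₀ (by positivity) (by positivity)]
  calc 6 * (3 * N - 2) * N ^ 3 ≤ 18 * N * N ^ 3 :=
        mul_le_mul_of_nonneg_right (by linarith) (by positivity)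
    _ = 18 * N ^ 2 * N ^ 2 := by ring
    _ ≤ 18 * N ^ 2 * (2 * ((N - 1) * (N - 2))) := mul_le_mul_of_nonneg_left hq (by positivity)
    _ = _ := by ring

lemma six_div_le' {N : ℝ} (hN : 6 ≤ N) : |6 / ((N - 1) * (N - 2))| ≤ 12 / N ^ 2 := by
  have h0 : 0 < N := by linarith
  have h1 : 0 < N - 1 := by linarith
  have h2 : 0 < N - 2 := by linarith
  rw [abs_of_nonneg (by positivity), div_le_div_iff₀ (by positivity) (by positivity)]
  nlinarith

lemma sq_mul_le_of_abs_le {a b y : ℝ} (h : |a| ≤ b) : (a * y) ^ 2 ≤ b ^ 2 * y ^ 2 := by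
  rw [mul_pow, ← sq_abs a]
  exact mul_le_mul_of_nonneg_right (pow_le_pow_left₀ (abs_nonneg _) h 2) (sq_nonneg _)

lemma abs_pseudoValue_le {n : ℕ} (hn : 6 ≤ n) {i : ℕ} (hi : i < n) (x : ℕ → ℝ) :
    |pseudoValue n x i| ≤ 102 := by
  have hN : (6 : ℝ) ≤ n := by exact_mod_cast hn
  have hN0 : (0 : ℝ) < n := by linarith
  rw [pseudoValue_eq (by omega) hi]
  refine (abs_sub _ _).trans ?_
  rw [abs_mul, abs_mul]
  have h1 := mul_le_mul (six_div_le hN) (abs_partialTotal_le n i x) (abs_nonneg _) (by positivity)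
  have h2 := mul_le_mul (twelve_div_le hN) (abs_total_le n x) (abs_nonneg _) (by positivity)
  have e1 : 18 / (n : ℝ) ^ 2 * (3 * (n : ℝ) ^ 2) = 54 := by field_simp; norm_num
  have e2 : 48 / (n : ℝ) ^ 3 * (n : ℝ) ^ 3 = 48 := by field_simp
  linarith

lemma bddMeas_pseudoValue (n i : ℕ) : BddMeas (fun x => pseudoValue n x i) := by
  refine ⟨(finiteMeas_pseudoValue n i).1, ?_⟩
  obtain ⟨C, hC⟩ := ((finiteMeas_pseudoValue n i).2.image abs).bddAbove
  exact ⟨C, fun x => hC ⟨_, ⟨x, rfl⟩, rfl⟩⟩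

/-! ### Approximation of the pseudo-values by independent scores. -/

section Score

variable (μ : Measure ℝ) [IsProbabilityMeasure μ]

/-- The normalized projection onto the `i`-th observation, which approximates the `i`-th
pseudo-value. -/
noncomputable def score (n i : ℕ) (a : ℝ) : ℝ := 6 / (n : ℝ) ^ 2 * proj μ n i a

/-- The mean of the variances of the scores. -/
noncomputable def scoreVar (n : ℕ) : ℝ :=
  (∑ i ∈ Finset.range n, ∫ a, score μ n i a ^ 2 ∂μ) / n

lemma bddMeas_score (n i : ℕ) : BddMeas (score μ n i) := (bddMeas_proj μ n i).const_mul _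

lemma abs_score_le {n : ℕ} (hn : 1 ≤ n) (i : ℕ) (a : ℝ) : |score μ n i a| ≤ 18 := by
  have hN0 : (0 : ℝ) < n := by exact_mod_cast hn
  unfold score
  rw [abs_mul, abs_of_nonneg (by positivity)]
  have h1 := mul_le_mul_of_nonneg_left (abs_proj_le μ n i a)
    (by positivity : 0 ≤ 6 / (n : ℝ) ^ 2)
  have e1 : 6 / (n : ℝ) ^ 2 * (3 * (n : ℝ) ^ 2) = 18 := by field_simp; norm_num
  linarith

lemma integral_score (h0 : ∫ a, firstProj μ a ∂μ = 0) (n i : ℕ) :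
    ∫ a, score μ n i a ∂μ = 0 := by
  unfold score
  rw [integral_const_mul, integral_proj μ h0, mul_zero]

/-- Three errors, each with second moment of order 1/n: the projection error of `partialTotal`, the
replacement of its coefficient by 6 / n², and the `total` term, whose coefficient is of order n⁻³
against a second moment of order n⁵. The constant 10⁷ is a round bound. -/
lemma integral_pseudoValue_sub_score_sq_le (h0 : ∫ a, firstProj μ a ∂μ = 0) {n : ℕ} (hn : 6 ≤ n)
    {i : ℕ} (hi : i < n) :
    ∫ x, (pseudoValue n x i - score μ n i (x i)) ^ 2 ∂(Measure.infinitePi (fun _ : ℕ => μ))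
      ≤ 10 ^ 7 / n := by
  set Q := Measure.infinitePi (fun _ : ℕ => μ) with hQ
  have hN : (6 : ℝ) ≤ n := by exact_mod_cast hn
  have hN0 : (0 : ℝ) < n := by linarith
  have hD : BddMeas (fun x : ℕ → ℝ => partialTotal n i x - proj μ n i (x i)) :=
    (bddMeas_partialTotal n i).sub ((bddMeas_proj μ n i).comp (measurable_pi_apply i))
  have hpt : ∀ x : ℕ → ℝ, (pseudoValue n x i - score μ n i (x i)) ^ 2
      ≤ 3 * (36 / (n : ℝ) ^ 4) * (partialTotal n i x - proj μ n i (x i)) ^ 2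
        + (3 * (48 / (n : ℝ) ^ 3) ^ 2 * total n x ^ 2 + 3 * (270 / (n : ℝ)) ^ 2) := by
    intro x
    have h1 : pseudoValue n x i - score μ n i (x i)
        = 6 / (n : ℝ) ^ 2 * (partialTotal n i x - proj μ n i (x i))
          + (6 / (((n : ℝ) - 2) * (n - 3)) - 6 / (n : ℝ) ^ 2) * partialTotal n i x
          - 12 / (((n : ℝ) - 1) * (n - 2) * (n - 3)) * total n x := by
      rw [pseudoValue_eq (by omega) hi, score]; ring
    rw [h1]
    have h2 : ((6 / (((n : ℝ) - 2) * (n - 3)) - 6 / (n : ℝ) ^ 2) * partialTotal n i x) ^ 2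
        ≤ (270 / (n : ℝ)) ^ 2 := by
      rw [← sq_abs, abs_mul]
      refine pow_le_pow_left₀ (by positivity) ?_ 2
      refine (mul_le_mul (six_div_sub_le hN) (abs_partialTotal_le n i x) (abs_nonneg _)
        (by positivity)).trans (le_of_eq ?_)
      field_simp; norm_num
    have h3 := sq_mul_le_of_abs_le (y := total n x) (twelve_div_le hN)
    have h4 : 36 / (n : ℝ) ^ 4 = (6 / (n : ℝ) ^ 2) ^ 2 := by rw [div_pow]; norm_num; ring
    rw [mul_assoc 3 (36 / (n : ℝ) ^ 4), h4, ← mul_pow]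
    set u := 6 / (n : ℝ) ^ 2 * (partialTotal n i x - proj μ n i (x i))
    set v := (6 / (((n : ℝ) - 2) * (n - 3)) - 6 / (n : ℝ) ^ 2) * partialTotal n i x
    set w := 12 / (((n : ℝ) - 1) * (n - 2) * (n - 3)) * total n x
    have h5 : (u + v - w) ^ 2 ≤ 3 * u ^ 2 + 3 * v ^ 2 + 3 * w ^ 2 := by
      nlinarith [sq_nonneg (u - v), sq_nonneg (u + w), sq_nonneg (v + w)]
    linarith
  have hb1 := hD.sq.const_mul (3 * (36 / (n : ℝ) ^ 4))
  have hb2 := (bddMeas_total n).sq.const_mul (3 * (48 / (n : ℝ) ^ 3) ^ 2)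
  have hb3 : BddMeas (fun _ : ℕ → ℝ => 3 * (270 / (n : ℝ)) ^ 2) := BddMeas.const _
  have hL : BddMeas (fun x : ℕ → ℝ => (pseudoValue n x i - score μ n i (x i)) ^ 2) :=
    ((bddMeas_pseudoValue n i).sub ((bddMeas_score μ n i).comp (measurable_pi_apply i))).sq
  refine (integral_mono (hL.integrable _) ((hb1.add (hb2.add hb3)).integrable _) hpt).trans ?_
  rw [integral_add (hb1.integrable _) ((hb2.add hb3).integrable _),
    integral_add (hb2.integrable _) (hb3.integrable _), integral_const_mul, integral_const_mul]
  have m1 := mul_le_mul_of_nonneg_left (integral_partialTotal_sub_proj_sq_le μ n i)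
    (by positivity : 0 ≤ 3 * (36 / (n : ℝ) ^ 4))
  have m2 := mul_le_mul_of_nonneg_left (integral_total_sq_le μ h0 (show 1 ≤ n by omega))
    (by positivity : 0 ≤ 3 * (48 / (n : ℝ) ^ 3) ^ 2)
  have e1 : 3 * (36 / (n : ℝ) ^ 4) * (144 * (n : ℝ) ^ 3) = 15552 / n := by field_simp; norm_num
  have e2 : 3 * (48 / (n : ℝ) ^ 3) ^ 2 * (1224 * (n : ℝ) ^ 5) = 8460288 / n := by
    field_simp; norm_num
  have e3 : 3 * (270 / (n : ℝ)) ^ 2 ≤ 218700 / n := by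
    rw [div_pow, mul_div_assoc', div_le_div_iff₀ (by positivity) hN0]
    nlinarith
  have e4 : (15552 : ℝ) / n + (8460288 / n + 218700 / n) ≤ 10 ^ 7 / n := by
    rw [← add_div, ← add_div]
    exact div_le_div_of_nonneg_right (by norm_num) hN0.le
  simp only [integral_const, probReal_univ, one_smul]
  linarith

/-- Adding up the individual bounds by Cauchy–Schwarz gives only O(1). The gain to O(1/n) comes from
projecting `total` as a whole. -/
lemma integral_sum_pseudoValue_sub_sum_score_sq_le (h0 : ∫ a, firstProj μ a ∂μ = 0) {n : ℕ}
    (hn : 6 ≤ n) :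
    ∫ x, ((∑ i ∈ Finset.range n, pseudoValue n x i) / √n
        - (∑ i ∈ Finset.range n, score μ n i (x i)) / √n) ^ 2
        ∂(Measure.infinitePi (fun _ : ℕ => μ)) ≤ 10 ^ 7 / n := by
  set Q := Measure.infinitePi (fun _ : ℕ => μ) with hQ
  have hN : (6 : ℝ) ≤ n := by exact_mod_cast hn
  have hN0 : (0 : ℝ) < n := by linarith
  have hD : BddMeas (fun x => total n x - projSum μ n x) :=
    (bddMeas_total n).sub (bddMeas_projSum μ n)
  have hpt : ∀ x : ℕ → ℝ, ((∑ i ∈ Finset.range n, pseudoValue n x i) / √n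
        - (∑ i ∈ Finset.range n, score μ n i (x i)) / √n) ^ 2
      ≤ 2 * (36 / (n : ℝ) ^ 5) * (total n x - projSum μ n x) ^ 2
        + 2 * ((36 / (n : ℝ) ^ 3) ^ 2 / n) * total n x ^ 2 := by
    intro x
    have h1 : ∑ i ∈ Finset.range n, pseudoValue n x i - ∑ i ∈ Finset.range n, score μ n i (x i)
        = 6 / (n : ℝ) ^ 2 * (total n x - projSum μ n x)
          + (6 / (((n : ℝ) - 1) * (n - 2)) - 6 / (n : ℝ) ^ 2) * total n x := by
      rw [sum_pseudoValue (by omega)]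
      simp only [score, projSum, ← Finset.mul_sum]
      ring
    rw [← sub_div, h1, div_pow, Real.sq_sqrt hN0.le, div_le_iff₀ hN0]
    have h3 := sq_mul_le_of_abs_le (y := total n x) (six_div_sub_le' hN)
    set u := total n x - projSum μ n x
    set w := (6 / (((n : ℝ) - 1) * (n - 2)) - 6 / (n : ℝ) ^ 2) * total n x
    have h5 : (6 / (n : ℝ) ^ 2 * u + w) ^ 2 ≤ 2 * (6 / (n : ℝ) ^ 2 * u) ^ 2 + 2 * w ^ 2 := by
      nlinarith [sq_nonneg (6 / (n : ℝ) ^ 2 * u - w)]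
    have h6 : (2 * (36 / (n : ℝ) ^ 5) * u ^ 2
        + 2 * ((36 / (n : ℝ) ^ 3) ^ 2 / n) * total n x ^ 2) * n
        = 2 * (6 / (n : ℝ) ^ 2 * u) ^ 2 + 2 * ((36 / (n : ℝ) ^ 3) ^ 2 * total n x ^ 2) := by
      field_simp; ring
    linarith
  have hb1 := hD.sq.const_mul (2 * (36 / (n : ℝ) ^ 5))
  have hb2 := (bddMeas_total n).sq.const_mul (2 * ((36 / (n : ℝ) ^ 3) ^ 2 / n))
  refine (integral_mono_of_nonneg (ae_of_all _ fun x => sq_nonneg _)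
    ((hb1.add hb2).integrable _) (ae_of_all _ hpt)).trans ?_
  rw [integral_add (hb1.integrable _) (hb2.integrable _), integral_const_mul, integral_const_mul]
  have m1 := mul_le_mul_of_nonneg_left (integral_total_sub_projSum_sq_le μ h0 n)
    (by positivity : 0 ≤ 2 * (36 / (n : ℝ) ^ 5))
  have m2 := mul_le_mul_of_nonneg_left (integral_total_sq_le μ h0 (show 1 ≤ n by omega))
    (by positivity : 0 ≤ 2 * ((36 / (n : ℝ) ^ 3) ^ 2 / n))
  have e1 : 2 * (36 / (n : ℝ) ^ 5) * (576 * (n : ℝ) ^ 4) = 41472 / n := by field_simp; norm_num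
  have e2 : 2 * ((36 / (n : ℝ) ^ 3) ^ 2 / n) * (1224 * (n : ℝ) ^ 5) ≤ 3172608 / n := by
    have : 2 * ((36 / (n : ℝ) ^ 3) ^ 2 / n) * (1224 * (n : ℝ) ^ 5) = 3172608 / n / n := by
      field_simp; norm_num
    rw [this]
    exact div_le_self (by positivity) (by linarith)
  have e4 : (41472 : ℝ) / n + 3172608 / n ≤ 10 ^ 7 / n := by
    rw [← add_div]
    exact div_le_div_of_nonneg_right (by norm_num) hN0.le
  linarith

lemma integral_sum_pseudoValue_sq_le (h0 : ∫ a, firstProj μ a ∂μ = 0) {n : ℕ} (hn : 6 ≤ n) :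
    ∫ x, ((∑ i ∈ Finset.range n, pseudoValue n x i) / √n) ^ 2
        ∂(Measure.infinitePi (fun _ : ℕ => μ)) ≤ 10 ^ 7 := by
  have hN : (6 : ℝ) ≤ n := by exact_mod_cast hn
  have hN0 : (0 : ℝ) < n := by linarith
  have hpt : ∀ x : ℕ → ℝ, ((∑ i ∈ Finset.range n, pseudoValue n x i) / √n) ^ 2
      ≤ (12 / (n : ℝ) ^ 2) ^ 2 / n * total n x ^ 2 := by
    intro x
    rw [sum_pseudoValue (by omega), div_pow, Real.sq_sqrt hN0.le, div_le_iff₀ hN0]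
    refine (sq_mul_le_of_abs_le (six_div_le' hN)).trans (le_of_eq ?_)
    field_simp
  refine (integral_mono_of_nonneg (ae_of_all _ fun x => sq_nonneg _)
    (((bddMeas_total n).sq.const_mul _).integrable _) (ae_of_all _ hpt)).trans ?_
  rw [integral_const_mul]
  have m2 := mul_le_mul_of_nonneg_left (integral_total_sq_le μ h0 (show 1 ≤ n by omega))
    (by positivity : 0 ≤ (12 / (n : ℝ) ^ 2) ^ 2 / n)
  have e2 : (12 / (n : ℝ) ^ 2) ^ 2 / n * (1224 * (n : ℝ) ^ 5) = 176256 := by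
    field_simp; norm_num
  linarith

/-- A law of large numbers for the independent, non-identically distributed squared scores: each
coordinate moves the mean by at most 18² / n. -/
lemma integral_mean_sq_score_sub_scoreVar_sq_le {n : ℕ} (hn : 1 ≤ n) :
    ∫ x, ((∑ i ∈ Finset.range n, score μ n i (x i) ^ 2) / n - scoreVar μ n) ^ 2
        ∂(Measure.infinitePi (fun _ : ℕ => μ)) ≤ 10 ^ 6 / n := by
  have hN0 : (0 : ℝ) < n := by exact_mod_cast hn
  have hsb : ∀ i, BddMeas (fun a => score μ n i a ^ 2 / n) := fun i => by
    simpa only [div_eq_inv_mul] using (bddMeas_score μ n i).sq.const_mul (n : ℝ)⁻¹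
  have hF : BddMeas (fun x : ℕ → ℝ => ∑ i ∈ Finset.range n, score μ n i (x i) ^ 2 / n) :=
    BddMeas.sum fun i _ => (hsb i).comp (measurable_pi_apply i)
  have hmean : ∫ x, ∑ i ∈ Finset.range n, score μ n i (x i) ^ 2 / n
      ∂(Measure.infinitePi (fun _ : ℕ => μ)) = scoreVar μ n := by
    rw [integral_finsetSum _ fun i _ => ((hsb i).comp (measurable_pi_apply i)).integrable _,
      scoreVar, Finset.sum_div]
    refine Finset.sum_congr rfl fun i _ => ?_
    rw [integral_eval_infinitePi μ (hsb i), integral_div]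
  have hes := efron_stein μ (Finset.range n) hF
    (dependsOn_sum_eval n fun i a => score μ n i a ^ 2 / n)
  rw [hmean] at hes
  simp_rw [Finset.sum_div]
  refine hes.trans ?_
  have hsq : ∀ i a, score μ n i a ^ 2 ≤ 324 := fun i a => by
    rw [← sq_abs]
    exact (pow_le_pow_left₀ (abs_nonneg _) (abs_score_le μ hn i a) 2).trans (by norm_num)
  have hinf : ∀ i ∈ Finset.range n, influence μ
      (fun x : ℕ → ℝ => ∑ i ∈ Finset.range n, score μ n i (x i) ^ 2 / n) i
      ≤ (324 / (n : ℝ)) ^ 2 := by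
    intro i hi
    refine influence_le μ hF fun x a => ?_
    have h2 := sum_eval_sub_update hi (fun i a => score μ n i a ^ 2 / n) x a
    beta_reduce at h2
    rw [h2, ← sub_div, abs_div, abs_of_pos hN0]
    refine div_le_div_of_nonneg_right ?_ hN0.le
    rw [abs_le]
    constructor <;> linarith [sq_nonneg (score μ n i (x i)), sq_nonneg (score μ n i a),
      hsq i (x i), hsq i a]
  refine (Finset.sum_le_sum hinf).trans ?_
  simp only [Finset.sum_const, Finset.card_range, nsmul_eq_mul]
  rw [div_pow, mul_div_assoc', div_le_div_iff₀ (by positivity) hN0]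
  nlinarith

lemma integral_mean_sq_pseudoValue_sub_scoreVar_sq_le (h0 : ∫ a, firstProj μ a ∂μ = 0) {n : ℕ}
    (hn : 6 ≤ n) :
    ∫ x, ((∑ i ∈ Finset.range n, pseudoValue n x i ^ 2) / n - scoreVar μ n) ^ 2
        ∂(Measure.infinitePi (fun _ : ℕ => μ)) ≤ 10 ^ 12 / n := by
  set Q := Measure.infinitePi (fun _ : ℕ => μ) with hQ
  have hN0 : (0 : ℝ) < n := by exact_mod_cast (show 0 < n by omega)
  have hDi : ∀ i, BddMeas (fun x : ℕ → ℝ => pseudoValue n x i - score μ n i (x i)) := fun i =>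
    (bddMeas_pseudoValue n i).sub ((bddMeas_score μ n i).comp (measurable_pi_apply i))
  have hDsum : BddMeas (fun x : ℕ → ℝ => ∑ i ∈ Finset.range n,
      (pseudoValue n x i - score μ n i (x i)) ^ 2) := BddMeas.sum fun i _ => (hDi i).sq
  have hE : BddMeas (fun x : ℕ → ℝ =>
      (∑ i ∈ Finset.range n, score μ n i (x i) ^ 2) / n - scoreVar μ n) := by
    have h1 : BddMeas (fun x : ℕ → ℝ => ∑ i ∈ Finset.range n, score μ n i (x i) ^ 2) :=
      BddMeas.sum fun i _ => ((bddMeas_score μ n i).comp (measurable_pi_apply i)).sq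
    simpa only [div_eq_inv_mul] using (h1.const_mul (n : ℝ)⁻¹).sub (BddMeas.const (scoreVar μ n))
  have hpt : ∀ x : ℕ → ℝ,
      ((∑ i ∈ Finset.range n, pseudoValue n x i ^ 2) / n - scoreVar μ n) ^ 2
      ≤ 2 * (120 ^ 2 / (n : ℝ)) * ∑ i ∈ Finset.range n, (pseudoValue n x i - score μ n i (x i)) ^ 2
        + 2 * ((∑ i ∈ Finset.range n, score μ n i (x i) ^ 2) / n - scoreVar μ n) ^ 2 := by
    intro x
    have h1 : (∑ i ∈ Finset.range n, (pseudoValue n x i ^ 2 - score μ n i (x i) ^ 2)) ^ 2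
        ≤ n * ∑ i ∈ Finset.range n, (pseudoValue n x i ^ 2 - score μ n i (x i) ^ 2) ^ 2 := by
      simpa only [Finset.card_range] using sq_sum_le_card_mul_sum_sq (s := Finset.range n)
        (f := fun i => pseudoValue n x i ^ 2 - score μ n i (x i) ^ 2)
    have h2 : ∀ i ∈ Finset.range n, (pseudoValue n x i ^ 2 - score μ n i (x i) ^ 2) ^ 2
        ≤ 120 ^ 2 * (pseudoValue n x i - score μ n i (x i)) ^ 2 := by
      intro i hi
      -- 120 = 102 + 18, the uniform bounds on pseudo-values and scores.
      have h3 : |pseudoValue n x i + score μ n i (x i)| ≤ 120 := (abs_add_le _ _).trans (by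
        linarith [abs_pseudoValue_le hn (Finset.mem_range.1 hi) x,
          abs_score_le μ (show 1 ≤ n by omega) i (x i)])
      rw [sq_sub_sq]
      exact sq_mul_le_of_abs_le h3
    have h4 := h1.trans (mul_le_mul_of_nonneg_left (Finset.sum_le_sum h2) hN0.le)
    rw [← Finset.mul_sum, Finset.sum_sub_distrib] at h4
    set p := ∑ i ∈ Finset.range n, pseudoValue n x i ^ 2
    set q := ∑ i ∈ Finset.range n, score μ n i (x i) ^ 2
    set d := ∑ i ∈ Finset.range n, (pseudoValue n x i - score μ n i (x i)) ^ 2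
    have h5 : ((p - q) / n) ^ 2 ≤ 120 ^ 2 / (n : ℝ) * d := by
      rw [div_pow, div_le_iff₀ (by positivity)]
      refine h4.trans (le_of_eq ?_)
      field_simp
    have h6 : p / n - scoreVar μ n = (p - q) / n + (q / n - scoreVar μ n) := by ring
    rw [h6]
    nlinarith [sq_nonneg ((p - q) / n - (q / n - scoreVar μ n))]
  have hb1 := hDsum.const_mul (2 * (120 ^ 2 / (n : ℝ)))
  have hb2 := hE.sq.const_mul 2
  refine (integral_mono_of_nonneg (ae_of_all _ fun x => sq_nonneg _)
    ((hb1.add hb2).integrable _) (ae_of_all _ hpt)).trans ?_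
  rw [integral_add (hb1.integrable _) (hb2.integrable _), integral_const_mul, integral_const_mul,
    integral_finsetSum _ fun i _ => (hDi i).sq.integrable _]
  have m1 : ∑ i ∈ Finset.range n, ∫ x, (pseudoValue n x i - score μ n i (x i)) ^ 2 ∂Q ≤ 10 ^ 7 := by
    refine (Finset.sum_le_sum fun i hi =>
      integral_pseudoValue_sub_score_sq_le μ h0 hn (Finset.mem_range.1 hi)).trans (le_of_eq ?_)
    simp only [Finset.sum_const, Finset.card_range, nsmul_eq_mul]
    field_simp
  have m2 := integral_mean_sq_score_sub_scoreVar_sq_le μ (show 1 ≤ n by omega)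
  have m3 := mul_le_mul_of_nonneg_left m1 (by positivity : 0 ≤ 2 * (120 ^ 2 / (n : ℝ)))
  have e1 : 2 * (120 ^ 2 / (n : ℝ)) * 10 ^ 7 = 288000000000 / n := by field_simp; norm_num
  have e2 : (288000000000 : ℝ) / n + 2 * (10 ^ 6 / n) ≤ 10 ^ 12 / n := by
    rw [mul_div_assoc', ← add_div]
    exact div_le_div_of_nonneg_right (by norm_num) hN0.le
  linarith

end Score

/-! ### Nondegeneracy of the variances of the scores. -/

section VarianceBound

variable (μ : Measure ℝ) [IsProbabilityMeasure μ]

lemma card_filter_fst_eq {n i : ℕ} (hi : i < n) :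
    ((triples (Finset.range n)).filter fun t => t.1 = i).card = i.choose 2 := by
  have h1 : (triples (Finset.range n)).filter (fun t => t.1 = i)
      = triples (Finset.range (i + 1)) \ triples (Finset.range i) := by
    ext t
    simp only [Finset.mem_filter, Finset.mem_sdiff, mem_triples, Finset.mem_range]
    omega
  have h2 : triples (Finset.range i) ⊆ triples (Finset.range (i + 1)) := by
    intro t
    simp only [mem_triples, Finset.mem_range]
    omega
  rw [h1, Finset.card_sdiff_of_subset h2, card_triples, card_triples, Finset.card_range,
    Finset.card_range, Nat.choose_succ_succ' i 2]
  exact Nat.add_sub_cancel _ _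

/-- If `i` is not the largest entry, the largest lies above it; few such triples exist when `i` is
close to `n`. -/
lemma card_filter_occurs_fst_ne_le {n i : ℕ} :
    ((triples (Finset.range n)).filter fun t => Occurs i t ∧ ¬t.1 = i).card
      ≤ 2 * n * (n - i) := by
  have hsub : ((triples (Finset.range n)).filter fun t => Occurs i t ∧ ¬t.1 = i) ⊆
      (Finset.Ico i n ×ˢ {i} ×ˢ Finset.range n) ∪ (Finset.Ico i n ×ˢ Finset.range n ×ˢ {i}) := by
    rintro ⟨a, b, c⟩ h
    rw [Finset.mem_filter, mem_triples] at h
    simp only [Occurs, Finset.mem_range] at h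
    simp only [Finset.mem_union, Finset.mem_product, Finset.mem_singleton, Finset.mem_Ico,
      Finset.mem_range]
    omega
  refine (Finset.card_le_card hsub).trans ((Finset.card_union_le _ _).trans ?_)
  simp only [Finset.card_product, Finset.card_singleton, Finset.card_range, Nat.card_Ico]
  exact le_of_eq (by ring)

lemma abs_proj_sub_le {n i : ℕ} (hi : i < n) (a : ℝ) :
    |proj μ n i a - (i.choose 2 : ℝ) * firstProj μ a| ≤ 2 * n * (n - i) := by
  have hsplit : ∀ x : ℕ → ℝ, partialTotal n i x
      = ∑ t ∈ triples (Finset.range n) with t.1 = i, kernAt t x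
        + ∑ t ∈ triples (Finset.range n) with Occurs i t ∧ ¬t.1 = i, kernAt t x := by
    intro x
    unfold partialTotal
    rw [← Finset.sum_filter_add_sum_filter_not ((triples (Finset.range n)).filter (Occurs i))
      (fun t => t.1 = i), Finset.filter_filter, Finset.filter_filter]
    congr 2
    ext t
    rw [Finset.mem_filter, Finset.mem_filter]
    refine and_congr_right fun _ => ⟨fun h => h.2, fun h => ⟨Or.inl h.symm, h⟩⟩
  have hb : ∀ t, BddMeas (fun x : ℕ → ℝ => kernAt t (Function.update x i a)) := fun t =>
    (bddMeas_kernAt t).update_left i a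
  unfold proj
  simp_rw [hsplit]
  rw [integral_add ((BddMeas.sum fun t _ => hb t).integrable _)
    ((BddMeas.sum fun t _ => hb t).integrable _),
    integral_finsetSum _ fun t _ => (hb t).integrable _]
  have h1 : ∑ t ∈ triples (Finset.range n) with t.1 = i,
      ∫ x, kernAt t (Function.update x i a) ∂(Measure.infinitePi (fun _ : ℕ => μ))
      = (i.choose 2 : ℝ) * firstProj μ a := by
    rw [← card_filter_fst_eq hi, ← nsmul_eq_mul, ← Finset.sum_const]
    refine Finset.sum_congr rfl fun t ht => ?_
    obtain ⟨ht1, rfl⟩ := Finset.mem_filter.1 ht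
    exact integral_kernAt_update μ ht1 a
  rw [h1, add_sub_cancel_left]
  have h2 := norm_integral_le_of_norm_le_const (μ := Measure.infinitePi (fun _ : ℕ => μ))
    (f := fun x => ∑ t ∈ triples (Finset.range n) with Occurs i t ∧ ¬t.1 = i,
      kernAt t (Function.update x i a))
    (ae_of_all _ fun x => abs_sum_kernAt_le _ _)
  rw [probReal_univ, mul_one] at h2
  refine h2.trans ?_
  have h3 : (((triples (Finset.range n)).filter fun t => Occurs i t ∧ ¬t.1 = i).card : ℝ)
      ≤ ((2 * n * (n - i) : ℕ) : ℝ) := by exact_mod_cast card_filter_occurs_fst_ne_le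
  rw [Nat.cast_mul, Nat.cast_sub hi.le] at h3
  exact_mod_cast h3

lemma integral_proj_sq_ge {n i : ℕ} (hi : i < n) :
    (i.choose 2 : ℝ) ^ 2 / 2 * ∫ a, firstProj μ a ^ 2 ∂μ - (2 * n * (n - i)) ^ 2
      ≤ ∫ a, proj μ n i a ^ 2 ∂μ := by
  have hb := (bddMeas_firstProj μ).sq.const_mul ((i.choose 2 : ℝ) ^ 2 / 2)
  have hpt : ∀ a, (i.choose 2 : ℝ) ^ 2 / 2 * firstProj μ a ^ 2 - (2 * n * ((n : ℝ) - i)) ^ 2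
      ≤ proj μ n i a ^ 2 := by
    intro a
    have h1 := abs_proj_sub_le μ hi a
    have h2 : (proj μ n i a - (i.choose 2 : ℝ) * firstProj μ a) ^ 2
        ≤ (2 * n * ((n : ℝ) - i)) ^ 2 := by
      rw [← sq_abs]; exact pow_le_pow_left₀ (abs_nonneg _) h1 2
    -- This is P² ≥ G² / 2 - (P - G)², equivalent to (2 P - G)² ≥ 0.
    nlinarith [sq_nonneg (2 * proj μ n i a - (i.choose 2 : ℝ) * firstProj μ a)]
  have := integral_mono ((hb.sub (BddMeas.const _)).integrable μ)
    ((bddMeas_proj μ n i).sq.integrable μ) hpt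
  rw [integral_sub (hb.integrable μ) (integrable_const _), integral_const_mul] at this
  simpa using this

/-- The variances of the scores do not degenerate. -/
lemma exists_le_scoreVar (hv : 0 < ∫ a, firstProj μ a ^ 2 ∂μ) :
    ∃ c > 0, ∀ᶠ n in atTop, c ≤ scoreVar μ n := by
  set v := ∫ a, firstProj μ a ^ 2 ∂μ with hvdef
  -- Only the last n / q indices are used. With q ≥ 4 they satisfy i ≥ 3 n / 4, so `i.choose 2` is
  -- at least n² / 8; with q ≥ 1024 / v the error of `abs_proj_sub_le` is at most half of the main
  -- term.
  obtain ⟨q, hq⟩ := exists_nat_ge (max 4 (1024 / v))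
  have hq4 : (4 : ℝ) ≤ q := (le_max_left _ _).trans hq
  have hqv : 1024 / v ≤ q := (le_max_right _ _).trans hq
  have hq0 : (0 : ℝ) < q := by linarith
  have hq4' : 4 ≤ q := by exact_mod_cast hq4
  -- Each index of the block contributes at least 36 v / 256, and the block is at least a fraction 1
  -- / (2 q) of all indices.
  refine ⟨36 * v / (512 * q), by positivity, ?_⟩
  filter_upwards [eventually_ge_atTop (2 * q), eventually_ge_atTop 8] with n hn hn8
  have hn0 : (0 : ℝ) < n := by exact_mod_cast (show 0 < n by omega)
  have hn8' : (8 : ℝ) ≤ n := by exact_mod_cast hn8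
  have hdiv : n / q * q ≤ n := Nat.div_mul_le_self n q
  have hdiv' : ((n / q : ℕ) : ℝ) ≤ n / q := Nat.cast_div_le
  have hdiv2 : (n : ℝ) / (2 * q) ≤ ((n / q : ℕ) : ℝ) := by
    have h1 : n < (n / q + 1) * q := by
      have := Nat.lt_div_mul_add (a := n) (b := q) (by omega)
      linarith [this, add_mul (n / q) 1 q]
    have h1' : (n : ℝ) < ((n / q : ℕ) + 1) * q := by exact_mod_cast h1
    have h2 : (2 : ℝ) * q ≤ n := by exact_mod_cast hn
    rw [div_le_iff₀ (by positivity)]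
    nlinarith
  have hterm : ∀ i ∈ Finset.Ico (n - n / q) n,
      36 * v / 256 ≤ ∫ a, score μ n i a ^ 2 ∂μ := by
    intro i hi
    obtain ⟨hi1, hi2⟩ := Finset.mem_Ico.1 hi
    have hnq : n / q ≤ n := Nat.div_le_self n q
    have hi1' : (n : ℝ) - i ≤ n / q := by
      have : (n : ℝ) ≤ i + (n / q : ℕ) := by exact_mod_cast (show n ≤ i + n / q by omega)
      linarith
    have hni0 : 0 ≤ (n : ℝ) - i := by
      have : (i : ℝ) ≤ n := by exact_mod_cast hi2.le
      linarith
    have hi34 : 3 * (n : ℝ) / 4 ≤ i := by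
      have : (n : ℝ) / q ≤ n / 4 := div_le_div_of_nonneg_left hn0.le (by norm_num) hq4
      linarith
    have hch : (n : ℝ) ^ 2 / 8 ≤ (i.choose 2 : ℝ) := by
      rw [Nat.cast_choose_two]
      nlinarith
    have hch2 : ((n : ℝ) ^ 2 / 8) ^ 2 ≤ (i.choose 2 : ℝ) ^ 2 :=
      pow_le_pow_left₀ (by positivity) hch 2
    have hR : (2 * (n : ℝ) * (n - i)) ^ 2 ≤ (n : ℝ) ^ 4 * (v / 256) := by
      have h1 : (2 * (n : ℝ) * (n - i)) ^ 2 ≤ (2 * n * (n / q)) ^ 2 :=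
        pow_le_pow_left₀ (by positivity) (mul_le_mul_of_nonneg_left hi1' (by positivity)) 2
      have h2 : (2 * (n : ℝ) * (n / q)) ^ 2 = (n : ℝ) ^ 4 * (4 / q ^ 2) := by
        field_simp; norm_num
      have h3 : 4 / (q : ℝ) ^ 2 ≤ v / 256 := by
        rw [div_le_iff₀ hv] at hqv
        rw [div_le_div_iff₀ (by positivity) (by norm_num)]
        nlinarith
      rw [h2] at h1
      exact h1.trans (mul_le_mul_of_nonneg_left h3 (by positivity))
    have h4 := integral_proj_sq_ge μ hi2
    rw [← hvdef] at h4
    have h5 : (n : ℝ) ^ 4 * (v / 256) ≤ ∫ a, proj μ n i a ^ 2 ∂μ := by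
      have h6 : ((n : ℝ) ^ 2 / 8) ^ 2 / 2 * v ≤ (i.choose 2 : ℝ) ^ 2 / 2 * v :=
        mul_le_mul_of_nonneg_right (by linarith) hv.le
      have h7 : ((n : ℝ) ^ 2 / 8) ^ 2 / 2 * v = (n : ℝ) ^ 4 * (v / 256) + (n : ℝ) ^ 4 * (v / 256) := by
        ring
      linarith
    unfold score
    simp_rw [mul_pow]
    rw [integral_const_mul]
    have h8 := mul_le_mul_of_nonneg_left h5 (by positivity : 0 ≤ (6 / (n : ℝ) ^ 2) ^ 2)
    refine le_trans (le_of_eq ?_) h8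
    field_simp
    norm_num
  have hsum : ((n / q : ℕ) : ℝ) * (36 * v / 256)
      ≤ ∑ i ∈ Finset.range n, ∫ a, score μ n i a ^ 2 ∂μ := by
    calc _ = ∑ i ∈ Finset.Ico (n - n / q) n, 36 * v / 256 := by
          rw [Finset.sum_const, Nat.card_Ico, Nat.sub_sub_self (Nat.div_le_self n q), nsmul_eq_mul]
      _ ≤ ∑ i ∈ Finset.Ico (n - n / q) n, ∫ a, score μ n i a ^ 2 ∂μ := Finset.sum_le_sum hterm
      _ ≤ _ := Finset.sum_le_sum_of_subset_of_nonneg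
          (fun i hi => Finset.mem_range.2 (Finset.mem_Ico.1 hi).2)
          fun i _ _ => integral_nonneg fun a => sq_nonneg _
  unfold scoreVar
  rw [le_div_iff₀ hn0]
  refine le_trans ?_ hsum
  refine le_trans (le_of_eq ?_) (mul_le_mul_of_nonneg_right hdiv2 (by positivity))
  field_simp
  norm_num

end VarianceBound

/-! ### Symmetry and nondegeneracy of the kernel under the Cauchy law. -/

section Cauchy

lemma cauchyMeasure_eq_withDensity :
    cauchyMeasure 0 1 = volume.withDensity (cauchyPDF 0 1) :=
  cauchyMeasure_of_scale_ne_zero 0 one_ne_zero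

lemma cauchyMeasure_absolutelyContinuous : cauchyMeasure 0 1 ≪ volume := by
  rw [cauchyMeasure_eq_withDensity]
  exact withDensity_absolutelyContinuous _ _

lemma absolutelyContinuous_cauchyMeasure : volume ≪ cauchyMeasure 0 1 := by
  rw [cauchyMeasure_eq_withDensity]
  refine withDensity_absolutelyContinuous' (by fun_prop) (ae_of_all _ fun x => ?_)
  rw [cauchyPDF_def]
  exact (ENNReal.ofReal_pos.2 (cauchyPDF_pos 0 one_ne_zero x)).ne'

lemma ae_cauchyMeasure_ne (y : ℝ) : ∀ᵐ x ∂(cauchyMeasure 0 1), x ≠ y := by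
  have h : ∀ᵐ x ∂(volume : Measure ℝ), x ≠ y := by
    rw [ae_iff]
    simp
  exact cauchyMeasure_absolutelyContinuous.ae_le h

lemma integral_cauchyMeasure_neg (f : ℝ → ℝ) :
    ∫ x, f (-x) ∂(cauchyMeasure 0 1) = ∫ x, f x ∂(cauchyMeasure 0 1) := by
  have hfin : ∀ᵐ x ∂(volume : Measure ℝ), cauchyPDF 0 1 x < ⊤ :=
    ae_of_all _ fun x => by rw [cauchyPDF_def]; exact ENNReal.ofReal_lt_top
  rw [cauchyMeasure_eq_withDensity,
    integral_withDensity_eq_integral_toReal_smul (measurable_cauchyPDF 0 1) hfin,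
    integral_withDensity_eq_integral_toReal_smul (measurable_cauchyPDF 0 1) hfin,
    ← integral_neg_eq_self (fun x => (cauchyPDF 0 1 x).toReal • f x)]
  simp [cauchyPDF_def, cauchyPDFReal_def]

/-- Negating `a` and `b` negates the threshold, so off the tie exactly one of the two indicators is
1. With the convention x / 0 = 0 this includes b = 0. -/
lemma kern_add_kern_neg {a b c : ℝ} (h : c ≠ (a * b - 1) / (2 * b)) :
    kern a b c + kern (-a) (-b) (-c) = 0 := by
  have h1 : (-a * -b - 1) / (2 * -b) = -((a * b - 1) / (2 * b)) := by
    rw [neg_mul_neg, mul_neg, div_neg]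
  unfold kern ind
  rw [h1]
  rcases lt_or_gt_of_ne h with h | h
  · rw [if_neg (not_le.2 h), if_pos (neg_le_neg h.le)]; norm_num
  · rw [if_pos h.le, if_neg (not_le.2 (neg_lt_neg h))]; norm_num

/-- Ties have probability zero for the atomless law, so the kernel is odd almost everywhere;
invariance under negation makes `firstProj` odd, hence of integral zero. -/
lemma integral_firstProj_cauchyMeasure :
    ∫ a, firstProj (cauchyMeasure 0 1) a ∂(cauchyMeasure 0 1) = 0 := by
  set ν := cauchyMeasure 0 1 with hν
  have h1 : ∀ a b, ∫ c, kern (-a) (-b) c ∂ν = -∫ c, kern a b c ∂ν := by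
    intro a b
    rw [← integral_cauchyMeasure_neg, ← integral_neg]
    refine integral_congr_ae ?_
    filter_upwards [ae_cauchyMeasure_ne ((a * b - 1) / (2 * b))] with c hc
    linarith [kern_add_kern_neg hc]
  have h2 : ∀ a, firstProj ν (-a) = -firstProj ν a := by
    intro a
    unfold firstProj
    rw [← integral_cauchyMeasure_neg, ← integral_neg]
    exact integral_congr_ae (ae_of_all _ fun b => h1 a b)
  have h3 := integral_cauchyMeasure_neg (firstProj ν)
  simp_rw [h2] at h3
  rw [integral_neg] at h3
  linarith

/-- For b ≠ 0 the threshold is (a - 1/b) / 2, which eventually exceeds `c`. -/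
lemma tendsto_kern_atTop {b : ℝ} (hb : b ≠ 0) (c : ℝ) :
    Tendsto (fun a => kern a b c) atTop (nhds (-1 / 2)) := by
  refine tendsto_const_nhds.congr' ?_
  filter_upwards [eventually_gt_atTop (2 * c + 1 / b)] with a ha
  have h1 : (a * b - 1) / (2 * b) = (a - 1 / b) / 2 := by field_simp
  have h2 : ¬(a * b - 1) / (2 * b) ≤ c := by
    rw [h1, not_le]; linarith
  unfold kern ind
  rw [if_neg h2]; norm_num

lemma tendsto_firstProj_atTop :
    Tendsto (firstProj (cauchyMeasure 0 1)) atTop (nhds (-1 / 2)) := by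
  set ν := cauchyMeasure 0 1 with hν
  have hb : ∀ a, BddMeas (fun p : ℝ × ℝ => kern a p.1 p.2) := fun a =>
    ⟨measurable_kern.comp (by fun_prop : Measurable fun p : ℝ × ℝ => (a, p.1, p.2)),
      1, fun p => abs_kern_le _ _ _⟩
  have h1 : ∀ a, firstProj ν a = ∫ p, kern a p.1 p.2 ∂(ν.prod ν) := fun a => by
    rw [integral_prod _ ((hb a).integrable _)]; rfl
  have h2 : Tendsto (fun a => ∫ p, kern a p.1 p.2 ∂(ν.prod ν)) atTop
      (nhds (∫ _, (-1 / 2 : ℝ) ∂(ν.prod ν))) := by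
    refine tendsto_integral_filter_of_dominated_convergence (fun _ => 1)
      (Eventually.of_forall fun a => (hb a).1.aestronglyMeasurable)
      (Eventually.of_forall fun a => ae_of_all _ fun p => abs_kern_le _ _ _)
      (integrable_const _) ?_
    have h3 : ∀ᵐ p ∂(ν.prod ν), p.1 ≠ 0 :=
      Measure.quasiMeasurePreserving_fst.ae (ae_cauchyMeasure_ne 0)
    filter_upwards [h3] with p hp
    exact tendsto_kern_atTop hp p.2
  simp only [integral_const, probReal_univ, one_smul] at h2
  exact h2.congr fun a => (h1 a).symm

/-- By its limit `firstProj` is negative on a half-line. That set has positive Lebesgue measure, and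
Lebesgue measure is absolutely continuous with respect to the Cauchy law. -/
lemma integral_firstProj_sq_pos :
    0 < ∫ a, firstProj (cauchyMeasure 0 1) a ^ 2 ∂(cauchyMeasure 0 1) := by
  set ν := cauchyMeasure 0 1 with hν
  have hb := bddMeas_firstProj ν
  refine lt_of_le_of_ne (integral_nonneg fun a => sq_nonneg _) fun h => ?_
  have h1 := (integral_eq_zero_iff_of_nonneg (fun a => sq_nonneg _) (hb.sq.integrable ν)).1 h.symm
  have h2 : ∀ᵐ a ∂(volume : Measure ℝ), firstProj ν a ^ 2 = 0 :=
    absolutelyContinuous_cauchyMeasure.ae_le h1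
  obtain ⟨A, hA⟩ := eventually_atTop.1
    (tendsto_firstProj_atTop.eventually_lt_const (show (-1 / 2 : ℝ) < 0 by norm_num))
  have h3 : Set.Ici A ⊆ {a | ¬firstProj ν a ^ 2 = 0} := fun a ha =>
    pow_ne_zero 2 (hA a ha).ne
  have h4 := measure_mono_null h3 (ae_iff.1 h2)
  simp at h4

end Cauchy

/-! ### The chi-squared limit. -/

section Limit

variable (μ : Measure ℝ) [IsProbabilityMeasure μ]

lemma measureReal_abs_ge_le {β : Type*} [MeasurableSpace β] (ν : Measure β)
    [IsProbabilityMeasure ν] {f : β → ℝ} (hf : BddMeas f) {δ : ℝ} (hδ : 0 < δ) :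
    ν.real {x | δ ≤ |f x|} ≤ (∫ x, f x ^ 2 ∂ν) / δ ^ 2 := by
  have h := mul_meas_ge_le_integral_of_nonneg (μ := ν) (f := fun x => f x ^ 2)
    (ae_of_all _ fun x => sq_nonneg _) (hf.sq.integrable ν) (δ ^ 2)
  have hset : {x | δ ^ 2 ≤ f x ^ 2} = {x | δ ≤ |f x|} := by
    ext x
    change δ ^ 2 ≤ f x ^ 2 ↔ δ ≤ |f x|
    rw [← sq_abs (f x), sq_le_sq₀ hδ.le (abs_nonneg _)]
  rw [hset] at h
  rw [le_div_iff₀ (by positivity)]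
  linarith

/-- The normalized sum of the scores. -/
noncomputable def scoreSum (n : ℕ) (x : ℕ → ℝ) : ℝ :=
  ∑ i ∈ Finset.range n, score μ n i (x i) / (√n * √(scoreVar μ n))

lemma tendstoInDistribution_scoreSum (h0 : ∫ a, firstProj μ a ∂μ = 0)
    (hv : 0 < ∫ a, firstProj μ a ^ 2 ∂μ) :
    TendstoInDistribution (scoreSum μ) atTop (id : ℝ → ℝ)
      (fun _ => Measure.infinitePi (fun _ : ℕ => μ)) (gaussianReal 0 1) := by
  obtain ⟨c, hc, hcv⟩ := exists_le_scoreVar μ hv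
  have hb : ∀ n i, BddMeas (fun a => score μ n i a / (√n * √(scoreVar μ n))) := fun n i => by
    simpa only [div_eq_inv_mul] using (bddMeas_score μ n i).const_mul (√n * √(scoreVar μ n))⁻¹
  refine tendstoInDistribution_triangular μ
    (f := fun n i a => score μ n i a / (√n * √(scoreVar μ n))) hb (fun n i => ?_)
    (β := fun n => 18 / (√n * √(scoreVar μ n))) (fun n i hi a => ?_) ?_ ?_
  · rw [integral_div, integral_score μ h0, zero_div]
  · rw [abs_div, abs_of_nonneg (by positivity : 0 ≤ √(n : ℝ) * √(scoreVar μ n))]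
    exact div_le_div_of_nonneg_right (abs_score_le μ (by omega) i a) (by positivity)
  · have hlim : Tendsto (fun n : ℕ => 18 / (√(n : ℝ) * √c)) atTop (nhds 0) :=
      tendsto_const_nhds.div_atTop ((Real.tendsto_sqrt_atTop.comp
        tendsto_natCast_atTop_atTop).atTop_mul_const (Real.sqrt_pos.2 hc))
    refine squeeze_zero' (Eventually.of_forall fun n => by positivity) ?_ hlim
    filter_upwards [hcv, eventually_ge_atTop 1] with n hn hn1
    have hn0 : (0 : ℝ) < n := by exact_mod_cast hn1
    have : 0 < √c := Real.sqrt_pos.2 hc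
    have : 0 < √(n : ℝ) := Real.sqrt_pos.2 hn0
    exact div_le_div_of_nonneg_left (by norm_num) (by positivity)
      (mul_le_mul_of_nonneg_left (Real.sqrt_le_sqrt hn) (by positivity))
  · filter_upwards [hcv, eventually_ge_atTop 1] with n hn hn1
    have hn0 : (0 : ℝ) < n := by exact_mod_cast hn1
    have hs0 : 0 < scoreVar μ n := hc.trans_le hn
    simp_rw [div_pow, integral_div, ← Finset.sum_div]
    rw [mul_pow, Real.sq_sqrt hn0.le, Real.sq_sqrt hs0.le]
    have : ∑ i ∈ Finset.range n, ∫ a, score μ n i a ^ 2 ∂μ = n * scoreVar μ n := by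
      unfold scoreVar; field_simp
    rw [this, div_self (by positivity)]

/-- The deterministic bound `exists_abs_log_ajelRatio_bound` applies with σ = √(`scoreVar μ n`) off
three exceptional events, whose probabilities Chebyshev's inequality controls. -/
lemma tendstoInMeasure_log_ajelRatio_sub (h0 : ∫ a, firstProj μ a ∂μ = 0)
    (hv : 0 < ∫ a, firstProj μ a ^ 2 ∂μ) :
    TendstoInMeasure (Measure.infinitePi (fun _ : ℕ => μ))
      ((fun (n : ℕ) (x : ℕ → ℝ) => -2 * Real.log (ajelRatio n x))
        - fun n x => scoreSum μ n x ^ 2) atTop 0 := by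
  set Q := Measure.infinitePi (fun _ : ℕ => μ) with hQ
  obtain ⟨c, hc, hcv⟩ := exists_le_scoreVar μ hv
  rw [tendstoInMeasure_iff_measureReal_dist]
  intro ε hε
  rw [Metric.tendsto_nhds]
  intro η hη
  -- Chosen so that 10⁷ / M² ≤ η / 4. Three events of probability at most η / 4 then leave the total
  -- below η.
  set M := 1 + 4 * 10 ^ 7 / η with hM
  have hM1 : 1 ≤ M := by rw [hM]; linarith [show 0 < 4 * 10 ^ 7 / η by positivity]
  have hM0 : 0 < M := by linarith
  have hMη : 10 ^ 7 / M ^ 2 ≤ η / 4 := by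
    rw [div_le_div_iff₀ (by positivity) (by norm_num)]
    have h1 : 4 * 10 ^ 7 ≤ η * M := by
      rw [hM, mul_add, mul_div_cancel₀ _ hη.ne']; linarith
    have h2 : η * M ≤ η * M ^ 2 := mul_le_mul_of_nonneg_left (by nlinarith) hη.le
    linarith
  obtain ⟨δ, hδ, hbound⟩ := exists_abs_log_ajelRatio_bound (K := 102) (by norm_num) hc hM0
    (half_pos hε)
  have hlim : Tendsto (fun n : ℕ => (10 ^ 12 / (n : ℝ)) / δ ^ 2) atTop (nhds 0) := by
    simpa using (tendsto_const_div_atTop_nhds_zero_nat (10 ^ 12 : ℝ)).div_const (δ ^ 2)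
  filter_upwards [hcv, hbound, hlim.eventually_le_const (show 0 < η / 4 by positivity),
    eventually_ge_atTop 6] with n hn hbn hsmall hn6
  have hn0 : (0 : ℝ) < n := by exact_mod_cast (show 0 < n by omega)
  have hsn : 0 < √(n : ℝ) := Real.sqrt_pos.2 hn0
  have hs0 : 0 < scoreVar μ n := hc.trans_le hn
  have hsq : √(scoreVar μ n) ^ 2 = scoreVar μ n := Real.sq_sqrt hs0.le
  have hss : 0 < √(scoreVar μ n) := Real.sqrt_pos.2 hs0
  have hscore : ∀ x, √(scoreVar μ n) * scoreSum μ n x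
      = (∑ i ∈ Finset.range n, score μ n i (x i)) / √n := by
    intro x
    unfold scoreSum
    rw [← Finset.sum_div]
    field_simp
  set d : (ℕ → ℝ) → ℝ := fun x => (∑ i ∈ Finset.range n, pseudoValue n x i) / √n with hd
  set e : (ℕ → ℝ) → ℝ := fun x => d x - (∑ i ∈ Finset.range n, score μ n i (x i)) / √n with he
  set r : (ℕ → ℝ) → ℝ :=
    fun x => (∑ i ∈ Finset.range n, pseudoValue n x i ^ 2) / n - scoreVar μ n with hr
  have hdb : BddMeas d := by
    simpa only [hd, div_eq_inv_mul] using
      (BddMeas.sum (s := Finset.range n) fun i _ => bddMeas_pseudoValue n i).const_mul (√(n : ℝ))⁻¹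
  have heb : BddMeas e := by
    refine hdb.sub ?_
    simpa only [div_eq_inv_mul] using (BddMeas.sum (s := Finset.range n) fun i _ =>
      (bddMeas_score μ n i).comp (measurable_pi_apply (X := fun _ : ℕ => ℝ) i)).const_mul
        (√(n : ℝ))⁻¹
  have hrb : BddMeas r := by
    refine BddMeas.sub ?_ (BddMeas.const _)
    simpa only [div_eq_inv_mul] using (BddMeas.sum (s := Finset.range n) fun i _ =>
      (bddMeas_pseudoValue n i).sq).const_mul (n : ℝ)⁻¹
  have hsub : {x | ε ≤ dist (((fun (n : ℕ) (x : ℕ → ℝ) => -2 * Real.log (ajelRatio n x))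
        - fun n x => scoreSum μ n x ^ 2) n x) ((0 : (ℕ → ℝ) → ℝ) x)}
      ⊆ {x | M ≤ |d x|} ∪ {x | δ ≤ |e x|} ∪ {x | δ ≤ |r x|} := by
    intro x hx
    by_contra hcon
    simp only [Set.mem_union, not_or] at hcon
    obtain ⟨⟨h1, h2⟩, h3⟩ := hcon
    have h1' : ¬M ≤ |d x| := h1
    have h2' : ¬δ ≤ |e x| := h2
    have h3' : ¬δ ≤ |r x| := h3
    have h4 := hbn x (√(scoreVar μ n)) (scoreSum μ n x) (by rw [hsq]; exact hn)
      (fun i hi => abs_pseudoValue_le hn6 hi x) (not_le.1 h1').le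
      (by rw [hscore]; exact (not_le.1 h2').le) (by rw [hsq]; exact (not_le.1 h3').le)
    have h5 : ε ≤ |-2 * Real.log (ajelRatio n x) - scoreSum μ n x ^ 2| := by
      have h6 : ε ≤ dist (-2 * Real.log (ajelRatio n x) - scoreSum μ n x ^ 2) 0 := hx
      rwa [Real.dist_eq, sub_zero] at h6
    linarith
  have hd2 : Q.real {x | M ≤ |d x|} ≤ η / 4 :=
    (measureReal_abs_ge_le Q hdb hM0).trans ((div_le_div_of_nonneg_right
      (integral_sum_pseudoValue_sq_le μ h0 hn6) (by positivity)).trans hMη)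
  have he2 : Q.real {x | δ ≤ |e x|} ≤ η / 4 :=
    (measureReal_abs_ge_le Q heb hδ).trans ((div_le_div_of_nonneg_right
      ((integral_sum_pseudoValue_sub_sum_score_sq_le μ h0 hn6).trans
        (div_le_div_of_nonneg_right (by norm_num) hn0.le)) (by positivity)).trans hsmall)
  have hr2 : Q.real {x | δ ≤ |r x|} ≤ η / 4 :=
    (measureReal_abs_ge_le Q hrb hδ).trans ((div_le_div_of_nonneg_right
      (integral_mean_sq_pseudoValue_sub_scoreVar_sq_le μ h0 hn6) (by positivity)).trans hsmall)
  have htot := (measureReal_mono (μ := Q) hsub).trans ((measureReal_union_le _ _).trans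
    (add_le_add_left (measureReal_union_le _ _) _))
  rw [Real.dist_eq, sub_zero, abs_of_nonneg measureReal_nonneg]
  linarith

/-- Under a nondegenerate centred kernel, the adjusted jackknife empirical log-likelihood ratio of
an i.i.d. sequence is asymptotically chi-squared. -/
theorem tendstoInDistribution_log_ajelRatio (h0 : ∫ a, firstProj μ a ∂μ = 0)
    (hv : 0 < ∫ a, firstProj μ a ^ 2 ∂μ) :
    TendstoInDistribution (fun (n : ℕ) (x : ℕ → ℝ) => -2 * Real.log (ajelRatio n x)) atTop
      (id : ℝ → ℝ) (fun _ => Measure.infinitePi (fun _ : ℕ => μ)) chiSquaredOne := by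
  -- Continuous mapping gives the limit of `scoreSum ^ 2`, and Slutsky's theorem transfers it to the
  -- statistic.
  have h1 := (tendstoInDistribution_scoreSum μ h0 hv).continuous_comp
    (g := fun z : ℝ => z ^ 2) (by fun_prop)
  have h2 := tendstoInDistribution_of_tendstoInMeasure_sub _ _ h1
    (tendstoInMeasure_log_ajelRatio_sub μ h0 hv)
    (fun n => (((measurable_ajelRatio n).log).const_mul (-2)).aemeasurable)
  refine ⟨h2.forall_aemeasurable, aemeasurable_id, ?_⟩
  convert! h2.tendsto using 2
  ext1
  simp only [Measure.map_id]
  rfl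

end Limit

end CauchyAJEL

theorem theorem4 {Ω : Type*} [MeasurableSpace Ω] (P : Measure Ω) [IsProbabilityMeasure P]
    (X : ℕ → Ω → ℝ) (hX : ∀ i, Measurable (X i)) (hindep : iIndepFun X P)
    -- the null hypothesis: the common law is the standard Cauchy distribution
    (hlaw : ∀ i, P.map (X i) = cauchyMeasure 0 1)
    (hsq : Integrable (fun ω => CauchyAJEL.h (X 0 ω) (X 1 ω) (X 2 ω) ^ 2) P)
    (hvar : 0 < variance
      (P[fun ω => CauchyAJEL.h (X 0 ω) (X 1 ω) (X 2 ω) |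
        MeasurableSpace.comap (X 0) inferInstance]) P) :
    -- the maximum is attained and has the Lagrange multiplier form
    (∀ n : ℕ, 4 ≤ n → ∀ ω : Ω,
      (∃ l : ℝ, CauchyAJEL.IsMultiplier (CauchyAJEL.adjustedValue n (fun i => X i ω)) l) ∧
      ∀ l : ℝ, CauchyAJEL.IsMultiplier (CauchyAJEL.adjustedValue n (fun i => X i ω)) l →
        CauchyAJEL.multiplierWeight (CauchyAJEL.adjustedValue n (fun i => X i ω)) l ∈
          CauchyAJEL.feasible (CauchyAJEL.adjustedValue n (fun i => X i ω)) ∧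
        IsMaxOn CauchyAJEL.likelihood
          (CauchyAJEL.feasible (CauchyAJEL.adjustedValue n (fun i => X i ω)))
          (CauchyAJEL.multiplierWeight (CauchyAJEL.adjustedValue n (fun i => X i ω)) l) ∧
        Real.log (CauchyAJEL.ajelRatio n (fun i => X i ω)) =
          -∑ i, Real.log (1 + l * CauchyAJEL.adjustedValue n (fun i => X i ω) i)) ∧
    -- convergence in distribution of the statistic
    TendstoInDistribution
      (fun (n : ℕ) (ω : Ω) => -2 * Real.log (CauchyAJEL.ajelRatio n (fun i => X i ω)))
      atTop (id : ℝ → ℝ) (fun _ => P) CauchyAJEL.chiSquaredOne := by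
  refine ⟨fun n hn ω => ⟨CauchyAJEL.exists_isMultiplier_adjustedValue (by omega) _, fun l hl =>
    ⟨CauchyAJEL.multiplierWeight_mem_feasible (Nat.succ_pos n) hl,
      CauchyAJEL.isMaxOn_likelihood (Nat.succ_pos n) hl,
      CauchyAJEL.log_elRatio (Nat.succ_pos n) hl⟩⟩, ?_⟩
  -- Convergence in distribution depends only on the joint law of the sequence, which is the
  -- infinite product of Cauchy laws.
  have hmap : P.map (fun ω i => X i ω) = Measure.infinitePi (fun _ : ℕ => cauchyMeasure 0 1) := by
    rw [hindep.map_fun_eq_infinitePi_map hX]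
    simp_rw [hlaw]
  have hmeas : Measurable (fun ω i => X i ω) := measurable_pi_lambda _ hX
  have hstat : ∀ n, Measurable (fun x : ℕ → ℝ => -2 * Real.log (CauchyAJEL.ajelRatio n x)) :=
    fun n => ((CauchyAJEL.measurable_ajelRatio n).log).const_mul (-2)
  have hlim := CauchyAJEL.tendstoInDistribution_log_ajelRatio (cauchyMeasure 0 1)
    CauchyAJEL.integral_firstProj_cauchyMeasure CauchyAJEL.integral_firstProj_sq_pos
  refine ⟨fun n => ((hstat n).comp hmeas).aemeasurable, aemeasurable_id, ?_⟩
  refine hlim.tendsto.congr fun n => Subtype.ext ?_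
  change _ = P.map ((fun x : ℕ → ℝ => -2 * Real.log (CauchyAJEL.ajelRatio n x)) ∘ fun ω i => X i ω)
  rw [← Measure.map_map (hstat n) hmeas, hmap]
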